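/- All graphs are finite, simple and undirected, and the order of a graph is its number of vertices. A path in a graph $G$ is monophonic (or induced) if it has no chords, i.e. no two of its vertices that are non-consecutive on the path are adjacent in $G$. A set $S$ of vertices of $G$ is in monophonic position if no monophonic path in $G$ contains more than two elements of $S$, and the monophonic position number of $G$ is the largest size of a set of vertices of $G$ in monophonic position. The diameter of $G$ is the largest distance between two vertices of $G$ (infinite if $G$ is disconnected). Theorem. For every integer $n \ge 0$, there is a graph with order $n$, monophonic position number $2$ and diameter $2$ if and only if $n \in \{3,4,5,8\}$ or $n \geq 11$. -/

import Mathlib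

namespace SimpleGraph

variable {V : Type*}

/-- A set `S` of vertices of `G` is in monophonic position if no monophonic path of `G`, that is,
no induced (chordless) path, contains more than two elements of `S`. -/
def IsMonophonicPosition (G : SimpleGraph V) (S : Set V) : Prop :=
  ∀ ⦃u v : V⦄ (p : G.Walk u v), p.IsPath → p.IsChordless →
    (S ∩ {x | x ∈ p.support}).ncard ≤ 2

open Classical in
/-- The monophonic position number of a finite graph: the size of a largest set of vertices in
monophonic position. -/
noncomputable def mpNumber [Fintype V] (G : SimpleGraph V) : ℕ :=
  (Finset.univ.filter fun S : Finset V => G.IsMonophonicPosition (S : Set V)).sup Finset.card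

end SimpleGraph

/-! Pairs are always in monophonic position, so for at least two vertices the monophonic position
number is 2 exactly when any three vertices lie on a common induced path. Diameter 2 adds that
nonadjacent vertices have a common neighbour. `IsTight` records both facts.

Necessity. A tight graph is triangle-free (`IsTight.not_triangle`); on more than four vertices it
has no twins (`IsTight.not_twins`), and on more than five its degrees are at least three. On six to
ten vertices some vertex `v` is cubic: if all degrees were at least 4, counting around an edge would
produce twins (`IsTight.exists_cubic`). Every vertex other than `v` and its neighbours `a`, `b`, `c`
is adjacent to one of these three. Hence an induced path through them has gaps of length 2 or 3, and
with at most ten vertices both gaps are 2 (`IsTight.linked_of_through`). This gives a frame `a p b q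
c` around `v`. Absence of twins makes adjacency to `a`, `b`, `c` nearly determine a vertex. Minimum
degree three forces eight vertices, and a ninth or tenth leads either to twins or to one of four
explicit graphs. Each of these has a triple on no induced path, found by searching all vertex
subsets (`IsTight.false_of_noPathCode`, `IsTight.card_eq_eight_of_frame`).

Sufficiency. `IsRich` is a checkable condition implying both properties. Orders 3, 4, 5, 8 use small
explicit graphs. For orders from 11 on, a hexagon is attached to an Andrásfai-type graph; orders 11
to 17 are computed. Beyond that, some three consecutive vertices avoid any given triple, and
deleting them leaves the graph three orders smaller (`hexGraph_isRich_add`). -/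

namespace SimpleGraph

variable {V : Type*} {G : SimpleGraph V}

/-! ### Induced paths as sequences, and the monophonic position number -/

/-- The vertices `f 0, …, f k` form an induced path in this order. -/
structure IsInducedPath (G : SimpleGraph V) (f : ℕ → V) (k : ℕ) : Prop where
  adj_iff : ∀ i ≤ k, ∀ j ≤ k, G.Adj (f i) (f j) ↔ i + 1 = j ∨ j + 1 = i
  inj : ∀ i ≤ k, ∀ j ≤ k, f i = f j → i = j

/-- Some induced path starts in `x`, passes through `y` and ends in `z`. -/
def InducedPathThrough (G : SimpleGraph V) (x y z : V) : Prop :=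
  ∃ f j k, G.IsInducedPath f k ∧ 0 < j ∧ j < k ∧ f 0 = x ∧ f j = y ∧ f k = z

/-- The three vertices lie on a common induced path. -/
def OnInducedPath (G : SimpleGraph V) (x y z : V) : Prop :=
  G.InducedPathThrough x y z ∨ G.InducedPathThrough y z x ∨ G.InducedPathThrough z x y

theorem IsInducedPath.shift {f : ℕ → V} {k : ℕ} (h : G.IsInducedPath f k) (i m : ℕ)
    (him : i + m ≤ k) : G.IsInducedPath (fun t => f (i + t)) m := by
  refine ⟨fun a ha b hb => ?_, fun a ha b hb hab => ?_⟩
  · rw [h.adj_iff _ (by omega) _ (by omega)]; omega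
  · have := h.inj _ (by omega) _ (by omega) hab; omega

theorem IsInducedPath.reverse {f : ℕ → V} {k : ℕ} (h : G.IsInducedPath f k) :
    G.IsInducedPath (fun t => f (k - t)) k := by
  refine ⟨fun a ha b hb => ?_, fun a ha b hb hab => ?_⟩
  · rw [h.adj_iff _ (by omega) _ (by omega)]; omega
  · have := h.inj _ (by omega) _ (by omega) hab; omega

theorem InducedPathThrough.symm {x y z : V} (h : G.InducedPathThrough x y z) :
    G.InducedPathThrough z y x := by
  obtain ⟨f, j, k, hf, h0, hjk, hx, hy, hz⟩ := h
  refine ⟨fun t => f (k - t), k - j, k, hf.reverse, by omega, by omega, ?_, ?_, ?_⟩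
  · simpa using hz
  · show f (k - (k - j)) = y
    rw [← hy, Nat.sub_sub_self hjk.le]
  · simpa using hx

theorem IsInducedPath.through {f : ℕ → V} {L i j k : ℕ} (h : G.IsInducedPath f L)
    (hij : i < j) (hjk : j < k) (hk : k ≤ L) : G.InducedPathThrough (f i) (f j) (f k) := by
  refine ⟨fun t => f (i + t), j - i, k - i, h.shift i _ (by omega), by omega, by omega, rfl, ?_, ?_⟩
  · show f _ = f _
    congr 1; omega
  · show f _ = f _
    congr 1; omega

/-- Chordlessness turns an adjacency between support vertices into an edge of the walk; injectivity
then forces the two positions to be consecutive. -/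
theorem Walk.isInducedPath_getVert {u v : V} {p : G.Walk u v} (hp : p.IsPath)
    (hc : p.IsChordless) : G.IsInducedPath p.getVert p.length := by
  have inj : ∀ i ≤ p.length, ∀ j ≤ p.length, p.getVert i = p.getVert j → i = j :=
    fun i hi j hj h => hp.getVert_injOn hi hj h
  refine ⟨fun i hi j hj => ⟨fun h => ?_, ?_⟩, inj⟩
  · have he := hc.mem_edges (p.getVert_mem_support i) (p.getVert_mem_support j) h
    obtain ⟨d, hd, hde⟩ := List.mem_map.1 he
    obtain ⟨n, hn, rfl⟩ := List.mem_iff_getElem.1 hd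
    rw [Walk.darts_getElem_eq_getVert] at hde
    rw [Walk.length_darts] at hn
    have := Sym2.eq_iff.1 hde
    simp only at this
    rcases this with ⟨h1, h2⟩ | ⟨h1, h2⟩
    · have := inj _ (by omega) _ (by omega) h1
      have := inj _ (by omega) _ (by omega) h2
      omega
    · have := inj _ (by omega) _ (by omega) h1
      have := inj _ (by omega) _ (by omega) h2
      omega
  · rintro (rfl | rfl)
    · exact p.adj_getVert_succ (by omega)
    · exact (p.adj_getVert_succ (by omega)).symm

theorem onInducedPath_of_mem_support {u v a b c : V} {p : G.Walk u v} (hp : p.IsPath)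
    (hc : p.IsChordless) (hab : a ≠ b) (hbc : b ≠ c) (hac : a ≠ c) (ha : a ∈ p.support)
    (hb : b ∈ p.support) (hcs : c ∈ p.support) : G.OnInducedPath a b c := by
  have hf := Walk.isInducedPath_getVert hp hc
  obtain ⟨i, rfl, hi⟩ := Walk.mem_support_iff_exists_getVert.1 ha
  obtain ⟨j, rfl, hj⟩ := Walk.mem_support_iff_exists_getVert.1 hb
  obtain ⟨k, rfl, hk⟩ := Walk.mem_support_iff_exists_getVert.1 hcs
  have hij : i ≠ j := by rintro rfl; exact hab rfl
  have hjk : j ≠ k := by rintro rfl; exact hbc rfl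
  have hik : i ≠ k := by rintro rfl; exact hac rfl
  unfold OnInducedPath
  by_cases h1 : i < j <;> by_cases h2 : j < k <;> by_cases h3 : i < k
  · exact Or.inl (hf.through h1 h2 hk)
  · omega
  · exact Or.inr (Or.inl (hf.through (i := i) (j := k) (k := j) h3 (by omega) hj).symm)
  · exact Or.inr (Or.inr (hf.through (by omega) h1 hj))
  · exact Or.inr (Or.inr (hf.through (i := j) (j := i) (k := k) (by omega) h3 hk).symm)
  · exact Or.inr (Or.inl (hf.through h2 (by omega) hi))
  · omega
  · exact Or.inl (hf.through (i := k) (j := j) (k := i) (by omega) (by omega) hi).symm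

/-- Otherwise `{a, b, c}` would be a set of size three in monophonic position. -/
theorem onInducedPath_of_mpNumber_eq_two [Fintype V] (h : G.mpNumber = 2) {a b c : V}
    (hab : a ≠ b) (hbc : b ≠ c) (hac : a ≠ c) : G.OnInducedPath a b c := by
  classical
  have hn : ¬ G.IsMonophonicPosition (({a, b, c} : Finset V) : Set V) := by
    intro hm
    have : ({a, b, c} : Finset V).card ≤ G.mpNumber :=
      Finset.le_sup (f := Finset.card) (by simpa using hm)
    rw [h, Finset.card_eq_three.2 ⟨a, b, c, hab, hac, hbc, rfl⟩] at this
    omega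
  simp only [IsMonophonicPosition, not_forall, not_le] at hn
  obtain ⟨u, v, p, hp, hc, hcard⟩ := hn
  have hsub : (({a, b, c} : Finset V) : Set V) ∩ {x | x ∈ p.support} = ({a, b, c} : Finset V) := by
    refine Set.eq_of_subset_of_ncard_le Set.inter_subset_left ?_
    rw [Set.ncard_coe_finset, Finset.card_eq_three.2 ⟨a, b, c, hab, hac, hbc, rfl⟩]
    omega
  have hmem : ∀ x ∈ ({a, b, c} : Finset V), x ∈ p.support := fun x hx =>
    ((Set.inter_eq_left.1 hsub) hx : x ∈ {x | x ∈ p.support})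
  exact onInducedPath_of_mem_support hp hc hab hbc hac (hmem a (by simp)) (hmem b (by simp))
    (hmem c (by simp))

theorem Walk.cons_chordless {u v w : V} {p : G.Walk u v} (hp : p.IsPath) (hc : p.IsChordless)
    (h : G.Adj w u) (hw : w ∉ p.support) (hn : ∀ x ∈ p.support, G.Adj w x → x = u) :
    (Walk.cons h p).IsPath ∧ (Walk.cons h p).IsChordless := by
  refine ⟨(Walk.cons_isPath_iff h p).2 ⟨hp, hw⟩, ?_⟩
  rw [Walk.isChordless_iff_forall_mem_edges] at hc ⊢
  intro x y hx hy hxy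
  rw [Walk.support_cons, List.mem_cons] at hx hy
  rw [Walk.edges_cons, List.mem_cons]
  rcases hx with rfl | hx <;> rcases hy with rfl | hy
  · exact absurd hxy (G.irrefl)
  · exact Or.inl (by rw [hn y hy hxy])
  · exact Or.inl (by rw [hn x hx hxy.symm, Sym2.eq_swap])
  · exact Or.inr (hc hx hy hxy)

/-- Some chordless path contains all three vertices. -/
def CoveredBy (G : SimpleGraph V) (a b c : V) : Prop :=
  ∃ u v, ∃ p : G.Walk u v, p.IsPath ∧ p.IsChordless ∧ a ∈ p.support ∧ b ∈ p.support ∧ c ∈ p.support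

/-- The hypothesis rules out sets of size three or more; any pair attains the value trivially. -/
theorem mpNumber_eq_two [Fintype V] (hV : 2 ≤ Fintype.card V)
    (h : ∀ a b c : V, a ≠ b → b ≠ c → a ≠ c → G.CoveredBy a b c) : G.mpNumber = 2 := by
  classical
  apply le_antisymm
  · refine Finset.sup_le fun S hS => ?_
    by_contra hcon
    obtain ⟨a, ha, b, hb, c, hc, hab, hac, hbc⟩ := Finset.two_lt_card.1 (not_le.1 hcon)
    obtain ⟨u, v, p, hp, hch, h1, h2, h3⟩ := h a b c hab hbc hac
    have := (Finset.mem_filter.1 hS).2 p hp hch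
    have hsub : (({a, b, c} : Finset V) : Set V) ⊆ (S : Set V) ∩ {x | x ∈ p.support} := by
      intro x hx
      simp only [Finset.coe_insert, Finset.coe_singleton, Set.mem_insert_iff,
        Set.mem_singleton_iff] at hx
      rcases hx with rfl | rfl | rfl
      exacts [⟨ha, h1⟩, ⟨hb, h2⟩, ⟨hc, h3⟩]
    have h4 := Set.ncard_le_ncard hsub (S.finite_toSet.subset Set.inter_subset_left)
    rw [Set.ncard_coe_finset, Finset.card_eq_three.2 ⟨a, b, c, hab, hac, hbc, rfl⟩] at h4
    omega
  · obtain ⟨S, -, hS⟩ := Finset.exists_subset_card_eq (s := (Finset.univ : Finset V)) (n := 2) hV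
    rw [← hS]
    refine Finset.le_sup (f := Finset.card) (Finset.mem_filter.2 ⟨Finset.mem_univ _, ?_⟩)
    intro u v p _ _
    refine (Set.ncard_le_ncard Set.inter_subset_left S.finite_toSet).trans ?_
    rw [Set.ncard_coe_finset, hS]

/-! ### Diameter two -/

/-- Distinct nonadjacent vertices have a common neighbour. -/
def CommonNbrs (G : SimpleGraph V) : Prop :=
  ∀ a b, a ≠ b → ¬ G.Adj a b → ∃ c, G.Adj a c ∧ G.Adj c b

theorem commonNbrs_of_ediam (h : G.ediam = 2) : G.CommonNbrs := by
  intro a b hab hnadj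
  have hle : G.edist a b ≤ 2 := h ▸ G.edist_le_ediam
  have hne : G.edist a b ≠ ⊤ := fun ht => by rw [ht] at hle; exact absurd hle (by decide)
  obtain ⟨p, hp⟩ := exists_walk_of_edist_ne_top hne
  rw [← hp] at hle
  have hl : p.length ≤ 2 := by exact_mod_cast hle
  match p, hl with
  | .nil, _ => exact absurd rfl hab
  | .cons h .nil, _ => exact absurd h hnadj
  | .cons h (.cons h' .nil), _ => exact ⟨_, h, h'⟩

theorem exists_nonadj_of_ediam (h : G.ediam = 2) :
    ∃ a b c, a ≠ b ∧ ¬ G.Adj a b ∧ G.Adj a c ∧ G.Adj c b := by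
  by_contra! hcon
  have hall : ∀ a b, a ≠ b → G.Adj a b := by
    intro a b hab
    by_contra hn
    obtain ⟨c, h1, h2⟩ := commonNbrs_of_ediam h a b hab hn
    exact hcon a b c hab hn h1 h2
  have : G.ediam ≤ 1 := by
    refine ediam_le_of_edist_le fun u v => ?_
    by_cases huv : u = v
    · simp [huv]
    · exact (edist_eq_one_iff_adj.2 (hall u v huv)).le
  rw [h] at this
  exact absurd this (by decide)

theorem ediam_eq_two (h : G.CommonNbrs) {a b : V} (hab : a ≠ b) (hn : ¬ G.Adj a b) :
    G.ediam = 2 := by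
  apply le_antisymm
  · refine ediam_le_of_edist_le fun u v => ?_
    by_cases huv : u = v
    · simp [huv]
    by_cases hadj : G.Adj u v
    · rw [edist_eq_one_iff_adj.2 hadj]; decide
    · obtain ⟨c, h1, h2⟩ := h u v huv hadj
      exact (Walk.edist_le (Walk.cons h1 (Walk.cons h2 .nil))).trans (by simp)
  · refine le_trans ?_ (G.edist_le_ediam (u := a) (v := b))
    by_contra hlt
    have h1 : G.edist a b ≤ 1 := Order.le_of_lt_add_one (not_le.1 hlt)
    have h0 : G.edist a b ≠ 0 := fun h0 => hab (edist_eq_zero_iff.1 h0)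
    exact hn (edist_eq_one_iff_adj.1 (le_antisymm h1 (Order.one_le_iff_ne_zero.2 h0)))

/-! ### Tight graphs: no triangles, no twins, minimum degree three -/

/-- Diameter at most two, and any three vertices lie on an induced path. -/
structure IsTight (G : SimpleGraph V) : Prop where
  nbrs : G.CommonNbrs
  onPath : ∀ {a b c : V}, a ≠ b → b ≠ c → a ≠ c → G.OnInducedPath a b c

theorem InducedPathThrough.not_adj {x y z : V} (h : G.InducedPathThrough x y z) :
    ¬ G.Adj x z := by
  obtain ⟨f, j, k, hf, h0, hjk, rfl, rfl, rfl⟩ := h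
  rw [hf.adj_iff _ (by omega) _ (by omega)]
  omega

/-- On a common induced path, the two outermost of the three vertices are nonadjacent. -/
theorem IsTight.not_triangle (h : G.IsTight) {a b c : V} (hab : G.Adj a b) (hbc : G.Adj b c)
    (hac : G.Adj a c) : False := by
  rcases h.onPath hab.ne hbc.ne hac.ne with h | h | h
  · exact h.not_adj hac
  · exact h.not_adj hab.symm
  · exact h.not_adj hbc.symm

/-- An end and an inner vertex of an induced path are not twins; if the two ends are twins, then
each inner vertex is adjacent to both. -/
theorem InducedPathThrough.twins {x y z : V} (h : G.InducedPathThrough x y z) :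
    ((∀ t, G.Adj x t ↔ G.Adj y t) → False) ∧ ((∀ t, G.Adj x t ↔ G.Adj z t) → G.Adj x y) := by
  obtain ⟨f, j, k, hf, h0, hjk, rfl, rfl, rfl⟩ := h
  constructor
  · intro ht
    -- The successor of the inner vertex would be adjacent to the start of the path.
    have := (ht (f (j + 1))).2 ((hf.adj_iff _ (by omega) _ (by omega)).2 (Or.inl rfl))
    rw [hf.adj_iff _ (by omega) _ (by omega)] at this
    omega
  · intro ht
    -- The second vertex of the path is adjacent to the last one too, so `k = 2` and `j = 1`.
    have := (ht (f 1)).1 ((hf.adj_iff _ (by omega) _ (by omega)).2 (Or.inl rfl))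
    rw [hf.adj_iff _ (by omega) _ (by omega)] at this
    rw [hf.adj_iff _ (by omega) _ (by omega)]
    omega

/-- An end and an inner vertex cannot be twins, so `a` and `b` are the ends and `c` lies between
them. -/
theorem IsTight.adj_of_twins (h : G.IsTight) {a b c : V} (hab : a ≠ b) (hac : a ≠ c)
    (hbc : b ≠ c) (ht : ∀ t, G.Adj a t ↔ G.Adj b t) : G.Adj a c := by
  rcases h.onPath hab hbc hac with h | h | h
  · exact (h.twins.1 ht).elim
  · exact (ht c).2 (h.twins.2 fun t => (ht t).symm)
  · exact (h.symm.twins.1 fun t => (ht t).symm).elim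

theorem exists_notMem_of_card [Fintype V] {n : ℕ} (hn : n < Fintype.card V) (l : List V)
    (hl : l.length ≤ n) : ∃ x, x ∉ l := by
  classical
  by_contra! hcon
  have : Fintype.card V ≤ l.toFinset.card := Finset.card_le_card fun x _ => by simpa using hcon x
  have := l.toFinset_card_le
  omega

/-- Twins are adjacent to every other vertex, so by triangle-freeness all other vertices have
neighbourhood `{a, b}`. Two of these are again twins and would have to be adjacent to a third. -/
theorem IsTight.not_twins [Fintype V] (h : G.IsTight) (hV : 4 < Fintype.card V) {a b : V}
    (hab : a ≠ b) (ht : ∀ t, G.Adj a t ↔ G.Adj b t) : False := by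
  obtain ⟨c, hc⟩ := exists_notMem_of_card hV [a, b] (by simp)
  obtain ⟨d, hd⟩ := exists_notMem_of_card hV [a, b, c] (by simp)
  obtain ⟨e, he⟩ := exists_notMem_of_card hV [a, b, c, d] (by simp)
  simp only [List.mem_cons, List.not_mem_nil, or_false, not_or] at hc hd he
  have key : ∀ t, t ≠ a → t ≠ b → G.Adj a t := fun t h1 h2 => h.adj_of_twins hab h1.symm h2.symm ht
  have nb : ∀ t, t ≠ a → t ≠ b → ∀ s, G.Adj t s ↔ s = a ∨ s = b := by
    intro t h1 h2 s
    constructor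
    · intro hts
      by_contra! hs
      exact h.not_triangle (key t h1 h2) hts (key s hs.1 hs.2)
    · rintro (rfl | rfl)
      · exact (key t h1 h2).symm
      · exact ((ht t).1 (key t h1 h2)).symm
  have := h.adj_of_twins (a := c) (b := d) (c := e) (Ne.symm hd.2.2) (Ne.symm he.2.2.1)
    (Ne.symm he.2.2.2) (fun t => by rw [nb c hc.1 hc.2, nb d hd.1 hd.2.1])
  rw [nb c hc.1 hc.2] at this
  exact this.elim he.1 he.2.1

/-- This is minimum degree three. A vertex with one neighbour makes the graph a star, which has
twins. If `v` has just the neighbours `a` and `b`, each of the two has at most one further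
neighbour, and these account for everything: at most five vertices. -/
theorem IsTight.exists_adj_notMem_two [Fintype V] (h : G.IsTight) (hV : 5 < Fintype.card V)
    (v a b : V) : ∃ x, G.Adj v x ∧ x ≠ a ∧ x ≠ b := by
  by_contra! hcon
  have hv : ∀ x, G.Adj v x → x = a ∨ x = b := fun x hx => by
    by_contra! hx'; exact hx'.2 (hcon x hx hx'.1)
  have nt : ∀ {x y z : V}, G.Adj x y → G.Adj y z → ¬ G.Adj x z :=
    fun h1 h2 h3 => h.not_triangle h1 h2 h3
  have one : ∀ a, (∀ x, G.Adj v x → x = a) → False := by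
    intro a hva
    obtain ⟨c, hc⟩ := exists_notMem_of_card hV [a, v] (by simp)
    obtain ⟨d, hd⟩ := exists_notMem_of_card hV [a, v, c] (by simp)
    simp only [List.mem_cons, List.not_mem_nil, or_false, not_or] at hc hd
    have ha : ∀ t, t ≠ a → t ≠ v → G.Adj t a ∧ G.Adj v a := by
      intro t h1 h2
      by_cases htv : G.Adj t v
      · exact absurd (hva t htv.symm) h1
      · obtain ⟨s, hs, hs'⟩ := h.nbrs t v h2 htv
        have hs'' := hva s hs'.symm
        subst hs''
        exact ⟨hs, hs'.symm⟩
    have hall : ∀ t, t ≠ a → ∀ s, G.Adj t s ↔ s = a := by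
      intro t h1 s
      by_cases h2 : t = v
      · subst h2; exact ⟨hva s, fun hs => hs ▸ (ha c hc.1 hc.2).2⟩
      refine ⟨fun hts => ?_, fun hs => hs ▸ (ha t h1 h2).1⟩
      by_contra hs
      by_cases h3 : s = v
      · subst h3; exact h1 (hva t hts.symm)
      · exact nt hts (ha s hs h3).1 (ha t h1 h2).1
    exact h.not_twins (by omega) (Ne.symm hd.2.2) fun t => by rw [hall c hc.1, hall d hd.1]
  by_cases hab : a = b
  · subst hab; exact one a fun x hx => (hv x hx).elim id id
  have hva : G.Adj v a := by
    by_contra hva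
    exact one b fun x hx => (hv x hx).elim (fun e => absurd (e ▸ hx) hva) id
  have hvb : G.Adj v b := by
    by_contra hvb
    exact one a fun x hx => (hv x hx).elim id (fun e => absurd (e ▸ hx) hvb)
  have hnab : ¬ G.Adj a b := nt hva.symm hvb
  have cov : ∀ t, t ≠ v → t ≠ a → t ≠ b → G.Adj t a ∨ G.Adj t b := by
    intro t h1 h2 h3
    have htv : ¬ G.Adj t v := fun hh => (hv t hh.symm).elim h2 h3
    obtain ⟨s, hs, hs'⟩ := h.nbrs t v h1 htv
    rcases hv s hs'.symm with rfl | rfl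
    exacts [Or.inl hs, Or.inr hs]
  -- Such a `t` would be a twin of `v`.
  have hnot : ∀ t, t ≠ v → G.Adj t a → G.Adj t b → False := by
    intro t h1 h2 h3
    refine h.not_twins (by omega) h1 fun s => ⟨fun hts => ?_, fun hs => ?_⟩
    · by_cases hsv : s = v
      · subst hsv; rcases hv t hts.symm with rfl | rfl
        exacts [absurd h2 G.irrefl, absurd h3 G.irrefl]
      by_cases hsa : s = a
      · rwa [hsa]
      by_cases hsb : s = b
      · rwa [hsb]
      rcases cov s hsv hsa hsb with h4 | h4
      exacts [(nt hts h4 h2).elim, (nt hts h4 h3).elim]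
    · rcases hv s hs with rfl | rfl <;> assumption
  -- at most one further neighbour of each of the two neighbours of `v`
  have uniq : ∀ a b, a ≠ b → G.Adj v a → G.Adj v b → (∀ x, G.Adj v x → x = a ∨ x = b) →
      (∀ t, t ≠ v → t ≠ a → t ≠ b → G.Adj t a ∨ G.Adj t b) →
      (∀ t, t ≠ v → G.Adj t a → G.Adj t b → False) → ∀ x y, x ≠ v → y ≠ v → G.Adj x a →
      G.Adj y a → x = y := by
    intro a b hab hva hvb hv cov hnot x y hxv hyv hx hy
    have hnab : ¬ G.Adj a b := nt hva.symm hvb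
    -- The right-hand side does not mention `x`, so two such vertices are twins.
    have nb : ∀ x, x ≠ v → G.Adj x a → ∀ s, G.Adj x s ↔ s = a ∨ (s ≠ v ∧ G.Adj s b) := by
      intro x hxv hx s
      constructor
      · intro hs
        by_cases hsa : s = a
        · exact Or.inl hsa
        by_cases hsv : s = v
        · subst hsv; rcases hv x hs.symm with rfl | rfl
          exacts [absurd hx G.irrefl, absurd hx.symm hnab]
        by_cases hsb : s = b
        · subst hsb; exact (hnot x hxv hx hs).elim
        · rcases cov s hsv hsa hsb with h4 | h4
          exacts [(nt hs h4 hx).elim, Or.inr ⟨hsv, h4⟩]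
      · rintro (rfl | ⟨hsv, hsb⟩)
        · exact hx
        by_contra hxs
        have hne : x ≠ s := by rintro rfl; exact hnot x hxv hx hsb
        obtain ⟨t, h1, h2⟩ := h.nbrs x s hne hxs
        have htv : t ≠ v := by
          rintro rfl; rcases hv x h1.symm with rfl | rfl
          exacts [absurd hx G.irrefl, absurd hx.symm hnab]
        have hta : t ≠ a := by rintro rfl; exact hnot s hsv h2.symm hsb
        have htb : t ≠ b := by rintro rfl; exact hnot x hxv hx h1
        rcases cov t htv hta htb with h4 | h4
        exacts [nt h1 h4 hx, nt h2.symm h4 hsb]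
    by_contra hxy
    exact h.not_twins (by omega) hxy fun t => by rw [nb x hxv hx, nb y hyv hy]
  obtain ⟨c, hc⟩ := exists_notMem_of_card hV [v, a, b] (by simp)
  obtain ⟨d, hd⟩ := exists_notMem_of_card hV [v, a, b, c] (by simp)
  obtain ⟨e, he⟩ := exists_notMem_of_card hV [v, a, b, c, d] (by simp)
  simp only [List.mem_cons, List.not_mem_nil, or_false, not_or] at hc hd he
  have ua := uniq a b hab hva hvb hv cov hnot
  have ub := uniq b a (Ne.symm hab) hvb hva (fun x hx => (hv x hx).symm)
    (fun t h1 h2 h3 => (cov t h1 h3 h2).symm) (fun t h1 h2 h3 => hnot t h1 h3 h2)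
  have hcd : d ≠ c := hd.2.2.2
  -- Two of `c`, `d`, `e` are attached to the same neighbour of `v`.
  rcases cov c hc.1 hc.2.1 hc.2.2 with h1 | h1 <;> rcases cov d hd.1 hd.2.1 hd.2.2.1 with h2 | h2 <;>
    rcases cov e he.1 he.2.1 he.2.2.1 with h3 | h3
  · exact hcd (ua d c hd.1 hc.1 h2 h1)
  · exact hcd (ua d c hd.1 hc.1 h2 h1)
  · exact he.2.2.2.1 (ua e c he.1 hc.1 h3 h1)
  · exact he.2.2.2.2 (ub e d he.1 hd.1 h3 h2)
  · exact he.2.2.2.2 (ua e d he.1 hd.1 h3 h2)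
  · exact he.2.2.2.1 (ub e c he.1 hc.1 h3 h1)
  · exact hcd (ub d c hd.1 hc.1 h2 h1)
  · exact hcd (ub d c hd.1 hc.1 h2 h1)

/-! ### Induced paths through the neighbours of a cubic vertex -/

/-- `x` and `y` have a common neighbour besides `v` which is not adjacent to `z`. -/
def Linked (G : SimpleGraph V) (v x y z : V) : Prop :=
  ∃ w, w ≠ v ∧ G.Adj w x ∧ G.Adj w y ∧ ¬ G.Adj w z

theorem IsTight.exists_common_nbr (h : G.IsTight) {v a b c t : V}
    (hv : ∀ x, G.Adj v x ↔ x = a ∨ x = b ∨ x = c) (htv : t ≠ v) (ha : t ≠ a) (hb : t ≠ b)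
    (hc : t ≠ c) : G.Adj t a ∨ G.Adj t b ∨ G.Adj t c := by
  have hn : ¬ G.Adj t v := fun hh => by
    rcases (hv t).1 hh.symm with h | h | h <;> contradiction
  obtain ⟨s, hs, hs'⟩ := h.nbrs t v htv hn
  rcases (hv s).1 hs'.symm with rfl | rfl | rfl
  exacts [Or.inl hs, Or.inr (Or.inl hs), Or.inr (Or.inr hs)]

/-- In a small tight graph, an induced path through the neighbours of a cubic vertex is short. -/
theorem IsTight.linked_of_through [Fintype V] (h : G.IsTight) (hV : Fintype.card V ≤ 10)
    {v a b c : V} (hv : ∀ x, G.Adj v x ↔ x = a ∨ x = b ∨ x = c)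
    (hp : G.InducedPathThrough a b c) : G.Linked v a b c ∧ G.Linked v b c a := by
  classical
  obtain ⟨f, j, k, hf, h0, hjk, rfl, rfl, rfl⟩ := hp
  have hadj : ∀ i ≤ k, ∀ i' ≤ k, G.Adj (f i) (f i') ↔ i + 1 = i' ∨ i' + 1 = i := hf.adj_iff
  have nt : ∀ {x y z : V}, G.Adj x y → G.Adj y z → ¬ G.Adj x z :=
    fun h1 h2 h3 => h.not_triangle h1 h2 h3
  have va : G.Adj v (f 0) := (hv _).2 (Or.inl rfl)
  have vb : G.Adj v (f j) := (hv _).2 (Or.inr (Or.inl rfl))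
  have vc : G.Adj v (f k) := (hv _).2 (Or.inr (Or.inr rfl))
  have fne : ∀ i ≤ k, ∀ i' ≤ k, i ≠ i' → f i ≠ f i' := fun i hi i' hi' hne he =>
    hne (hf.inj i hi i' hi' he)
  have hnv : ∀ m ≤ k, f m ≠ v := by
    intro m hm he
    rw [← he, hadj _ (by omega) _ (by omega)] at va vb vc
    omega
  -- Every other vertex of the path is next to `f 0`, `f j` or `f k`, so the two gaps are at most 3.
  -- Gap 1 would close a triangle with `v`.
  have cov : ∀ m ≤ k, m ≠ 0 → m ≠ j → m ≠ k → m = 1 ∨ m + 1 = j ∨ j + 1 = m ∨ m + 1 = k := by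
    intro m hm m0 mj mk
    rcases h.exists_common_nbr hv (hnv m hm) (fne m hm 0 (by omega) m0) (fne m hm j hjk.le mj)
      (fne m hm k le_rfl mk) with h1 | h1 | h1
    all_goals rw [hadj _ (by omega) _ (by omega)] at h1; omega
  have j2 : j ≠ 1 := fun hj => by
    have : G.Adj (f 0) (f j) := (hadj _ (by omega) _ (by omega)).2 (by omega)
    exact nt va this vb
  have k2 : k ≠ j + 1 := fun hj => by
    have : G.Adj (f j) (f k) := (hadj _ (by omega) _ (by omega)).2 (by omega)
    exact nt vb this vc
  have j3 : j ≤ 3 := by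
    by_contra hj
    have := cov 2 (by omega) (by omega) (by omega) (by omega)
    omega
  have k3 : k ≤ j + 3 := by
    by_contra hj
    have := cov (j + 2) (by omega) (by omega) (by omega) (by omega)
    omega
  have hj : j = 2 ∨ j = 3 := by omega
  have hk : k = j + 2 ∨ k = j + 3 := by omega
  -- a vertex with a neighbour on each of two sides
  have nbr : ∀ s, s ≠ f 0 → s ≠ f j → s ≠ f k → s ≠ v →
      G.Adj s (f 0) ∨ G.Adj s (f j) ∨ G.Adj s (f k) := fun s h1 h2 h3 h4 =>
    h.exists_common_nbr hv h4 h1 h2 h3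
  have vn : ∀ m ≤ k, m ≠ 0 → m ≠ j → m ≠ k → ¬ G.Adj v (f m) := by
    intro m hm m0 mj mk hvm
    rcases (hv _).1 hvm with h1 | h1 | h1
    exacts [m0 (hf.inj _ hm _ (by omega) h1), mj (hf.inj _ hm _ (by omega) h1),
      mk (hf.inj _ hm _ (by omega) h1)]
  have yes : ∀ i i', i ≤ k → i' ≤ k → (i + 1 = i' ∨ i' + 1 = i) → G.Adj (f i) (f i') :=
    fun i i' hi hi' hh => (hadj i hi i' hi').2 hh
  have no : ∀ i i', i ≤ k → i' ≤ k → ¬ (i + 1 = i' ∨ i' + 1 = i) → ¬ G.Adj (f i) (f i') :=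
    fun i i' hi hi' hh => fun h' => hh ((hadj i hi i' hi').1 h')
  rcases hj with rfl | rfl <;> rcases hk with rfl | rfl
  · exact ⟨⟨f 1, hnv 1 (by omega), yes _ _ (by omega) (by omega) (by omega),
      yes _ _ (by omega) (by omega) (by omega), no _ _ (by omega) (by omega) (by omega)⟩,
      ⟨f 3, hnv 3 (by omega), yes _ _ (by omega) (by omega) (by omega),
      yes _ _ (by omega) (by omega) (by omega), no _ _ (by omega) (by omega) (by omega)⟩⟩
  -- With gaps 2 and 3, a common neighbour of `f 1` and `f 4` forms a triangle with whichever
  -- neighbour of `v` it is adjacent to. Gaps 3 and 2 behave alike.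
  · exfalso
    obtain ⟨u, hu1, hu2⟩ := h.nbrs (f 1) (f 4) (fne _ (by omega) _ (by omega) (by omega))
      (no _ _ (by omega) (by omega) (by omega))
    have e0 : u ≠ f 0 := by rintro rfl; exact no 0 4 (by omega) (by omega) (by omega) hu2
    have e2 : u ≠ f 2 := by rintro rfl; exact no 2 4 (by omega) (by omega) (by omega) hu2
    have e5 : u ≠ f 5 := by rintro rfl; exact no 1 5 (by omega) (by omega) (by omega) hu1
    have ev : u ≠ v := by
      rintro rfl; exact vn 1 (by omega) (by omega) (by omega) (by omega) hu1.symm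
    rcases nbr u e0 e2 e5 ev with h1 | h1 | h1
    · exact nt hu1 h1 (yes _ _ (by omega) (by omega) (by omega))
    · exact nt hu1 h1 (yes _ _ (by omega) (by omega) (by omega))
    · exact nt hu2.symm h1 (yes _ _ (by omega) (by omega) (by omega))
  · exfalso
    obtain ⟨u, hu1, hu2⟩ := h.nbrs (f 1) (f 4) (fne _ (by omega) _ (by omega) (by omega))
      (no _ _ (by omega) (by omega) (by omega))
    have e0 : u ≠ f 0 := by rintro rfl; exact no 0 4 (by omega) (by omega) (by omega) hu2
    have e2 : u ≠ f 3 := by rintro rfl; exact no 1 3 (by omega) (by omega) (by omega) hu1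
    have e5 : u ≠ f 5 := by rintro rfl; exact no 1 5 (by omega) (by omega) (by omega) hu1
    have ev : u ≠ v := by
      rintro rfl; exact vn 1 (by omega) (by omega) (by omega) (by omega) hu1.symm
    rcases nbr u e0 e2 e5 ev with h1 | h1 | h1
    · exact nt hu1 h1 (yes _ _ (by omega) (by omega) (by omega))
    · exact nt hu2.symm h1 (yes _ _ (by omega) (by omega) (by omega))
    · exact nt hu2.symm h1 (yes _ _ (by omega) (by omega) (by omega))
  · exfalso
    -- With both gaps 3, the pairs `(1, 5)`, `(1, 4)`, `(2, 5)` have common neighbours off the path.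
    -- Their respective adjacencies to `f 3`, `f 6`, `f 0` make them distinct, so with `v` and the
    -- seven path vertices there are eleven vertices.
    have get : ∀ i i', i ≤ 6 → i' ≤ 6 → i + 2 < i' → i ≠ 0 → i ≠ 3 → i' ≠ 3 → i' ≠ 6 →
        ∃ u, G.Adj (f i) u ∧ G.Adj u (f i') ∧ (∀ m ≤ 6, u ≠ f m) ∧ u ≠ v := by
      intro i i' hi hi' hii h1 h2 h3 h4
      obtain ⟨u, hu1, hu2⟩ := h.nbrs (f i) (f i') (fne _ (by omega) _ (by omega) (by omega))
        (no _ _ (by omega) (by omega) (by omega))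
      refine ⟨u, hu1, hu2, fun m hm he => ?_, ?_⟩
      · rw [he, hadj _ (by omega) _ (by omega)] at hu1 hu2
        omega
      · rintro rfl; exact vn i (by omega) (by omega) (by omega) (by omega) hu1.symm
    obtain ⟨u1, x1, y1, n1, v1⟩ := get 1 5 (by omega) (by omega) (by omega) (by omega) (by omega)
      (by omega) (by omega)
    obtain ⟨u2, x2, y2, n2, v2⟩ := get 1 4 (by omega) (by omega) (by omega) (by omega) (by omega)
      (by omega) (by omega)
    obtain ⟨u3, x3, y3, n3, v3⟩ := get 2 5 (by omega) (by omega) (by omega) (by omega) (by omega)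
      (by omega) (by omega)
    have a10 : G.Adj (f 1) (f 0) := yes _ _ (by omega) (by omega) (by omega)
    have a23 : G.Adj (f 2) (f 3) := yes _ _ (by omega) (by omega) (by omega)
    have a43 : G.Adj (f 4) (f 3) := yes _ _ (by omega) (by omega) (by omega)
    have a56 : G.Adj (f 5) (f 6) := yes _ _ (by omega) (by omega) (by omega)
    have b1 : G.Adj u1 (f 3) := by
      rcases nbr u1 (n1 _ (by omega)) (n1 _ (by omega)) (n1 _ (by omega)) v1 with h1 | h1 | h1
      exacts [(nt x1 h1 a10).elim, h1, (nt y1.symm h1 a56).elim]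
    have c2 : G.Adj u2 (f 6) := by
      rcases nbr u2 (n2 _ (by omega)) (n2 _ (by omega)) (n2 _ (by omega)) v2 with h1 | h1 | h1
      exacts [(nt x2 h1 a10).elim, (nt y2.symm h1 a43).elim, h1]
    have a3 : G.Adj u3 (f 0) := by
      rcases nbr u3 (n3 _ (by omega)) (n3 _ (by omega)) (n3 _ (by omega)) v3 with h1 | h1 | h1
      exacts [h1, (nt x3 h1 a23).elim, (nt y3.symm h1 a56).elim]
    have u12 : u1 ≠ u2 := by rintro rfl; exact nt y1.symm c2 a56
    have u13 : u1 ≠ u3 := by rintro rfl; exact nt x1 a3 a10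
    have u23 : u2 ≠ u3 := by rintro rfl; exact nt x2 a3 a10
    have hnd : (v :: u1 :: u2 :: u3 :: (List.range 7).map f).Nodup := by
      have hr : ((List.range 7).map f).Nodup := by
        refine List.Nodup.map_on (fun x hx y hy hxy => ?_) List.nodup_range
        exact hf.inj x (by have := List.mem_range.1 hx; omega) y
          (by have := List.mem_range.1 hy; omega) hxy
      have aux : ∀ u, (∀ m ≤ 6, u ≠ f m) → u ∉ (List.range 7).map f := by
        intro u hu hmem
        obtain ⟨m, hm, rfl⟩ := List.mem_map.1 hmem
        exact hu m (by have := List.mem_range.1 hm; omega) rfl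
      have auxv := aux v fun m hm => (hnv m hm).symm
      simp only [List.nodup_cons, List.mem_cons, not_or]
      exact ⟨⟨v1.symm, v2.symm, v3.symm, auxv⟩, ⟨u12, u13, aux _ n1⟩, ⟨u23, aux _ n2⟩,
        aux _ n3, hr⟩
    have := hnd.length_le_card
    simp at this
    omega

theorem IsTight.linked [Fintype V] (h : G.IsTight) (hV : Fintype.card V ≤ 10)
    {v a b c : V} (hab : a ≠ b) (hbc : b ≠ c) (hac : a ≠ c)
    (hv : ∀ x, G.Adj v x ↔ x = a ∨ x = b ∨ x = c) :
    (G.Linked v a b c ∧ G.Linked v b c a) ∨ (G.Linked v b c a ∧ G.Linked v c a b) ∨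
      (G.Linked v c a b ∧ G.Linked v a b c) := by
  rcases h.onPath hab hbc hac with hp | hp | hp
  · exact Or.inl (h.linked_of_through hV hv hp)
  · exact Or.inr (Or.inl (h.linked_of_through hV (fun x => by rw [hv]; tauto) hp))
  · exact Or.inr (Or.inr (h.linked_of_through hV (fun x => by rw [hv]; tauto) hp))

/-! ### Degrees along an induced path -/

open Classical in
/-- Degree conditions for the vertex set of an induced path with ends `x` and `z`. -/
theorem InducedPathThrough.indicator [Fintype V] {x y z : V} (h : G.InducedPathThrough x y z) :
    ∃ σ : V → ℕ, (∀ t, σ t ≤ 1) ∧ σ x = 1 ∧ σ y = 1 ∧ σ z = 1 ∧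
      ∑ s ∈ G.neighborFinset x, σ s = 1 ∧ ∑ s ∈ G.neighborFinset z, σ s = 1 ∧
      ∀ t, t ≠ x → t ≠ z → σ t = 1 → ∑ s ∈ G.neighborFinset t, σ s = 2 := by
  obtain ⟨f, j, k, hf, h0, hjk, rfl, rfl, rfl⟩ := h
  have key : ∀ m ≤ k, ∑ s ∈ G.neighborFinset (f m), (if ∃ i ≤ k, f i = s then 1 else 0) =
      ((Finset.range (k + 1)).filter fun i => m + 1 = i ∨ i + 1 = m).card := by
    intro m hm
    rw [Finset.sum_ite, Finset.sum_const_zero, add_zero, Finset.sum_const, smul_eq_mul, mul_one]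
    symm
    refine Finset.card_bij (fun i _ => f i) ?_ ?_ ?_
    · intro i hi
      simp only [Finset.mem_filter, Finset.mem_range] at hi
      simp only [Finset.mem_filter, mem_neighborFinset]
      exact ⟨(hf.adj_iff m hm i (by omega)).2 hi.2, i, by omega, rfl⟩
    · intro i hi i' hi' he
      simp only [Finset.mem_filter, Finset.mem_range] at hi hi'
      exact hf.inj i (by omega) i' (by omega) he
    · intro s hs
      simp only [Finset.mem_filter, mem_neighborFinset] at hs
      obtain ⟨hs, i, hi, rfl⟩ := hs
      exact ⟨i, by simpa using ⟨by omega, (hf.adj_iff m hm i hi).1 hs⟩, rfl⟩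
  refine ⟨fun s => if ∃ i ≤ k, f i = s then 1 else 0, fun t => ?_, ?_, ?_, ?_, ?_, ?_, ?_⟩
  · dsimp only; split_ifs <;> omega
  · exact if_pos ⟨0, by omega, rfl⟩
  · exact if_pos ⟨j, by omega, rfl⟩
  · exact if_pos ⟨k, by omega, rfl⟩
  · rw [key 0 (by omega), Finset.card_eq_one]
    refine ⟨1, ?_⟩
    ext i
    simp only [Finset.mem_filter, Finset.mem_range, Finset.mem_singleton]
    omega
  · rw [key k le_rfl, Finset.card_eq_one]
    refine ⟨k - 1, ?_⟩
    ext i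
    simp only [Finset.mem_filter, Finset.mem_range, Finset.mem_singleton]
    omega
  · intro t ht0 htk ht
    have ht' : ∃ i ≤ k, f i = t := by
      by_contra hcon
      have := ht.symm.trans (if_neg hcon)
      omega
    obtain ⟨m, hm, rfl⟩ := ht'
    have m0 : m ≠ 0 := by rintro rfl; exact ht0 rfl
    have mk : m ≠ k := by rintro rfl; exact htk rfl
    rw [key m hm, Finset.card_eq_two]
    refine ⟨m - 1, m + 1, by omega, ?_⟩
    ext i
    simp only [Finset.mem_filter, Finset.mem_range, Finset.mem_singleton, Finset.mem_insert]
    omega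

/-! ### Existence of a cubic vertex -/

open Classical in
theorem IsTight.three_le_degree [Fintype V] (h : G.IsTight) (hV : 5 < Fintype.card V) (v : V) :
    3 ≤ G.degree v := by
  obtain ⟨a, ha, -⟩ := h.exists_adj_notMem_two hV v v v
  obtain ⟨b, hb, hba, -⟩ := h.exists_adj_notMem_two hV v a a
  obtain ⟨c, hc, hca, hcb⟩ := h.exists_adj_notMem_two hV v a b
  have hsub : ({a, b, c} : Finset V) ⊆ G.neighborFinset v := by
    intro x hx
    simp only [Finset.mem_insert, Finset.mem_singleton] at hx
    rw [mem_neighborFinset]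
    rcases hx with rfl | rfl | rfl <;> assumption
  have := Finset.card_le_card hsub
  rwa [Finset.card_eq_three.2 ⟨a, b, c, hba.symm, hca.symm, hcb.symm, rfl⟩,
    card_neighborFinset_eq_degree] at this

-- Suppose all degrees are at least 4, and let `R` be the set of vertices adjacent to neither end of
-- an edge `uv`. As the neighbourhoods of `u` and `v` are disjoint, `R` has at most two elements.
-- Degree counting leaves only two possibilities: `R` is empty and neighbours of `u` are twins, or
-- `R` consists of two twins.
open Classical in
theorem IsTight.exists_cubic [Fintype V] (h : G.IsTight) (hV : 5 < Fintype.card V)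
    (hV' : Fintype.card V ≤ 10) : ∃ v, G.degree v = 3 := by
  by_contra! hcon
  have hdeg : ∀ v, 4 ≤ G.degree v := fun v => by
    have := h.three_le_degree hV v
    have := hcon v
    omega
  have nt : ∀ {x y z : V}, G.Adj x y → G.Adj y z → ¬ G.Adj x z :=
    fun h1 h2 h3 => h.not_triangle h1 h2 h3
  obtain ⟨u, -⟩ := exists_notMem_of_card (V := V) (n := 0) (by omega) [] (by simp)
  obtain ⟨v, huv, -⟩ := h.exists_adj_notMem_two hV u u u
  set R : Finset V := Finset.univ.filter fun t => ¬ G.Adj u t ∧ ¬ G.Adj v t with hR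
  have memR : ∀ t, t ∈ R ↔ ¬ G.Adj u t ∧ ¬ G.Adj v t := fun t => by simp [hR]
  have hsplit : ∀ S : Finset V, S.card = (S.filter (G.Adj u)).card + (S.filter (G.Adj v)).card +
      (S.filter (· ∈ R)).card := by
    intro S
    rw [← Finset.card_filter_add_card_filter_not (s := S) (G.Adj u), add_assoc, add_right_inj,
      ← Finset.card_filter_add_card_filter_not (s := S.filter fun t => ¬ G.Adj u t) (G.Adj v),
      Finset.filter_filter, Finset.filter_filter]
    congr 2
    · ext t
      simp only [Finset.mem_filter]
      exact ⟨fun ht => ⟨ht.1, ht.2.2⟩, fun ht => ⟨ht.1, fun hu => nt huv ht.2 hu, ht.2⟩⟩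
    · ext t
      simp only [Finset.mem_filter, memR]
  have deg_eq : ∀ t, (Finset.univ.filter (G.Adj t)).card = G.degree t := fun t => by
    rw [← card_neighborFinset_eq_degree, neighborFinset_eq_filter]
  have htot := hsplit Finset.univ
  have hRR : (Finset.univ.filter (· ∈ R)) = R := by ext; simp
  rw [deg_eq, deg_eq, hRR, Finset.card_univ] at htot
  have du := hdeg u
  have dv := hdeg v
  -- the degree of a vertex of one side, and of a vertex of `R`
  have bound : ∀ u v, G.Adj u v → R = Finset.univ.filter (fun t => ¬ G.Adj u t ∧ ¬ G.Adj v t) →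
      ∀ p x, G.Adj p x → G.Adj u x →
      4 + ((G.neighborFinset p).filter (G.Adj v)).card ≤
        G.degree v + ((G.neighborFinset x).filter (· ∈ R)).card := by
    intro u v huv hR p x hpx hux
    have h1 : G.neighborFinset x ⊆ ((G.neighborFinset v) \
        ((G.neighborFinset p).filter (G.Adj v))) ∪ (G.neighborFinset x).filter (· ∈ R) := by
      intro t ht
      have ht' := ht
      rw [mem_neighborFinset] at ht
      rw [Finset.mem_union, Finset.mem_sdiff, Finset.mem_filter, Finset.mem_filter,
        mem_neighborFinset, mem_neighborFinset]
      by_cases hvt : G.Adj v t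
      · exact Or.inl ⟨hvt, fun hh => nt hpx ht hh.1⟩
      · exact Or.inr ⟨ht', by rw [hR]; simpa using ⟨nt hux ht, hvt⟩⟩
    have h2 := (Finset.card_le_card h1).trans (Finset.card_union_le _ _)
    have h3 : (G.neighborFinset p).filter (G.Adj v) ⊆ G.neighborFinset v := fun t ht => by
      rw [mem_neighborFinset]; exact (Finset.mem_filter.1 ht).2
    rw [Finset.card_sdiff_of_subset h3, card_neighborFinset_eq_degree,
      card_neighborFinset_eq_degree] at h2
    have h4 := Finset.card_le_card h3
    rw [card_neighborFinset_eq_degree] at h4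
    have := hdeg x
    omega
  have boundu := bound u v huv hR
  have boundv := bound v u huv.symm (by rw [hR]; ext; simp [and_comm])
  have pne : ∀ p ∈ R, p ≠ u ∧ p ≠ v := fun p hp =>
    ⟨fun e => ((memR p).1 hp).2 (e ▸ huv.symm), fun e => ((memR p).1 hp).1 (e ▸ huv)⟩
  have nbru : ∀ p ∈ R, ∃ x, G.Adj p x ∧ G.Adj u x := fun p hp => by
    obtain ⟨x, h1, h2⟩ := h.nbrs p u (pne p hp).1 fun e => ((memR p).1 hp).1 e.symm
    exact ⟨x, h1, h2.symm⟩
  have nbrv : ∀ p ∈ R, ∃ x, G.Adj p x ∧ G.Adj v x := fun p hp => by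
    obtain ⟨x, h1, h2⟩ := h.nbrs p v (pne p hp).2 fun e => ((memR p).1 hp).2 e.symm
    exact ⟨x, h1, h2.symm⟩
  have hfR : ∀ x, ((G.neighborFinset x).filter (· ∈ R)).card ≤ R.card := fun x =>
    Finset.card_le_card fun t ht => (Finset.mem_filter.1 ht).2
  have hself : ∀ p ∈ R, ((G.neighborFinset p).filter (· ∈ R)) ⊆ R.erase p := by
    intro p hp t ht
    rw [Finset.mem_filter, mem_neighborFinset] at ht
    exact Finset.mem_erase.2 ⟨ht.1.ne', ht.2⟩
  have hselfc : ∀ p ∈ R, ((G.neighborFinset p).filter (· ∈ R)).card + 1 ≤ R.card := by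
    intro p hp
    have := Finset.card_le_card (hself p hp)
    rw [Finset.card_erase_of_mem hp] at this
    have := Finset.card_pos.2 ⟨p, hp⟩
    omega
  have hdegp := fun p => hsplit (G.neighborFinset p)
  simp only [card_neighborFinset_eq_degree] at hdegp
  have hRc : R.card = 0 ∨ R.card = 1 ∨ R.card = 2 := by omega
  rcases hRc with hRc | hRc | hRc
  · have cov : ∀ t, G.Adj u t ∨ G.Adj v t := by
      intro t
      by_contra! ht
      rw [Finset.card_eq_zero] at hRc
      have := (memR t).2 ht
      simp [hRc] at this
    have nb : ∀ x, G.Adj u x → ∀ t, G.Adj x t ↔ G.Adj v t := by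
      intro x hx t
      constructor
      · intro hxt
        exact (cov t).resolve_left fun hu => nt hx hxt hu
      · intro hvt
        by_contra hxt
        have hne : x ≠ t := by rintro rfl; exact nt huv hvt hx
        obtain ⟨s, h1, h2⟩ := h.nbrs x t hne hxt
        rcases cov s with hs | hs
        · exact nt hx h1 hs
        · exact nt hvt h2.symm hs
    obtain ⟨w, hw, hwv, -⟩ := h.exists_adj_notMem_two hV u v v
    exact h.not_twins (by omega) hwv (nb w hw)
  · obtain ⟨p, hp⟩ := Finset.card_pos.1 (show 0 < R.card by omega)
    obtain ⟨x, h1, h2⟩ := nbru p hp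
    obtain ⟨y, h3, h4⟩ := nbrv p hp
    have := boundu p x h1 h2
    -- Adding both bounds to the degree of `p` gives `12 ≤ 9 + 2`.
    have := boundv p y h3 h4
    have := hdegp p
    have := hdeg p
    have := hfR x
    have := hfR y
    have := hselfc p hp
    omega
  · have main : ∀ p q, p ∈ R → q ∈ R → p ≠ q → R = {p, q} → ∀ t, G.Adj p t → G.Adj q t := by
      intro p q hp hq hpq hRpq t hpt
      obtain ⟨x, h1, h2⟩ := nbru p hp
      obtain ⟨y, h3, h4⟩ := nbrv p hp
      have b1 := boundu p x h1 h2
      have b2 := boundv p y h3 h4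
      have d := hdegp p
      have := hdeg p
      by_cases hadj : G.Adj p q
      · exfalso
        have aux : ∀ x, G.Adj p x → ((G.neighborFinset x).filter (· ∈ R)).card ≤ 1 := by
          intro x hx
          have : (G.neighborFinset x).filter (· ∈ R) ⊆ {p} := by
            intro s hs
            rw [Finset.mem_filter, mem_neighborFinset, hRpq, Finset.mem_insert,
              Finset.mem_singleton] at hs
            rcases hs with ⟨hs, rfl | rfl⟩
            · simp
            · exact (nt hx hs hadj).elim
          simpa using Finset.card_le_card this
        have := aux x h1
        have := aux y h3
        have := hselfc p hp
        omega
      · have : ((G.neighborFinset p).filter (· ∈ R)).card = 0 := by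
          rw [Finset.card_eq_zero, Finset.filter_eq_empty_iff]
          intro s hs hsR
          rw [mem_neighborFinset] at hs
          rw [hRpq, Finset.mem_insert, Finset.mem_singleton] at hsR
          rcases hsR with rfl | rfl
          exacts [G.irrefl hs, hadj hs]
        -- The same count is now tight: `12 ≤ 8 + 4`. So each neighbour of `p` is adjacent to all of
        -- `R`, in particular to `q`.
        have big : ∀ s, G.Adj p s →
            2 ≤ ((G.neighborFinset s).filter (· ∈ R)).card → G.Adj q s := by
          intro s hs hc
          have he : (G.neighborFinset s).filter (· ∈ R) = R := by
            refine Finset.eq_of_subset_of_card_le (fun t ht => (Finset.mem_filter.1 ht).2) ?_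
            omega
          rw [← he, Finset.mem_filter, mem_neighborFinset] at hq
          exact hq.1.symm
        have f1 := hfR x
        have f2 := hfR y
        by_cases hut : G.Adj u t
        · exact big t hpt (by have := boundu p t hpt hut; omega)
        by_cases hvt : G.Adj v t
        · exact big t hpt (by have := boundv p t hpt hvt; omega)
        have htR := (memR t).2 ⟨hut, hvt⟩
        rw [hRpq, Finset.mem_insert, Finset.mem_singleton] at htR
        rcases htR with rfl | rfl
        exacts [(G.irrefl hpt).elim, (hadj hpt).elim]
    obtain ⟨p, q, hpq, he⟩ := Finset.card_eq_two.1 hRc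
    have hp : p ∈ R := by rw [he]; simp
    have hq : q ∈ R := by rw [he]; simp
    refine h.not_twins (by omega) hpq fun t => ⟨main p q hp hq hpq he t,
      main q p hq hp hpq.symm (by rw [he, Finset.pair_comm]) t⟩

/-! ### Excluding explicit graphs by a search over vertex subsets -/

/-- The graph with the listed edges. -/
abbrev ofEdges {n : ℕ} (E : List (Fin n × Fin n)) : SimpleGraph (Fin n) :=
  fromRel fun i j => (i, j) ∈ E

/-- Distinct nonadjacent vertices are joined by walks of length two and of length three. -/
def PentagonRich {n : ℕ} (H : SimpleGraph (Fin n)) : Prop :=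
  ∀ i j, i ≠ j → ¬ H.Adj i j →
    (∃ k, H.Adj i k ∧ H.Adj k j) ∧ ∃ k, H.Adj i k ∧ ∃ l, H.Adj k l ∧ H.Adj l j

instance {n : ℕ} (H : SimpleGraph (Fin n)) [DecidableRel H.Adj] : Decidable H.PentagonRich := by
  unfold PentagonRich; infer_instance

/-- The number of neighbours of `i` in the set coded by the binary digits of `m`. -/
def codeDegree {n : ℕ} (H : SimpleGraph (Fin n)) [DecidableRel H.Adj] (m : ℕ) (i : Fin n) : ℕ :=
  (List.finRange n).countP fun j : Fin n => m.testBit j && decide (H.Adj i j)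

/-- The set coded by `m` contains `x`, `y`, `z` and has the degrees of an induced path, two of
these three being its ends. -/
def IsPathCode {n : ℕ} (H : SimpleGraph (Fin n)) [DecidableRel H.Adj] (x y z : Fin n) (m : ℕ) :
    Prop :=
  (m.testBit x = true ∧ m.testBit y = true ∧ m.testBit z = true) ∧
    (1 ≤ codeDegree H m x ∧ 1 ≤ codeDegree H m y ∧ 1 ≤ codeDegree H m z ∧
      codeDegree H m x + codeDegree H m y + codeDegree H m z = 4) ∧
    ∀ t : Fin n, t ≠ x ∧ t ≠ y ∧ t ≠ z ∧ m.testBit t = true → codeDegree H m t = 2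

instance {n : ℕ} (H : SimpleGraph (Fin n)) [DecidableRel H.Adj] (x y z : Fin n) (m : ℕ) :
    Decidable (IsPathCode H x y z m) := by
  unfold IsPathCode; infer_instance

-- The ends have degree 1 and the middle one degree 2, so the sum 4 with all terms positive covers
-- every order of the three vertices.
open Classical in
theorem OnInducedPath.indicator [Fintype V] {x y z : V} (h : G.OnInducedPath x y z) (hxy : x ≠ y)
    (hyz : y ≠ z) (hxz : x ≠ z) :
    ∃ σ : V → ℕ, (∀ t, σ t ≤ 1) ∧ σ x = 1 ∧ σ y = 1 ∧ σ z = 1 ∧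
      1 ≤ ∑ s ∈ G.neighborFinset x, σ s ∧ 1 ≤ ∑ s ∈ G.neighborFinset y, σ s ∧
      1 ≤ ∑ s ∈ G.neighborFinset z, σ s ∧
      ∑ s ∈ G.neighborFinset x, σ s + ∑ s ∈ G.neighborFinset y, σ s +
        ∑ s ∈ G.neighborFinset z, σ s = 4 ∧
      ∀ t, t ≠ x → t ≠ y → t ≠ z → σ t = 1 → ∑ s ∈ G.neighborFinset t, σ s = 2 := by
  rcases h with h | h | h <;> obtain ⟨σ, h1, h2, h3, h4, h5, h6, h7⟩ := h.indicator
  · have := h7 y hxy.symm hyz h3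
    exact ⟨σ, h1, h2, h3, h4, by omega, by omega, by omega, by omega,
      fun t ht _ ht' => h7 t ht ht'⟩
  · have := h7 z hyz.symm hxz.symm h3
    exact ⟨σ, h1, h4, h2, h3, by omega, by omega, by omega, by omega,
      fun t ht ht' _ => h7 t ht' ht⟩
  · have := h7 x hxz hxy h3
    exact ⟨σ, h1, h3, h4, h2, by omega, by omega, by omega, by omega,
      fun t _ ht ht' => h7 t ht' ht⟩

/-- Identifying two nonadjacent vertices would close a walk of length three into a triangle. -/
theorem IsTight.hom_injective (h : G.IsTight) {n : ℕ} {H : SimpleGraph (Fin n)}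
    (hH : H.PentagonRich) {e : Fin n → V} (he : ∀ i j, H.Adj i j → G.Adj (e i) (e j)) :
    Function.Injective e := by
  intro i j hij
  by_contra hne
  by_cases hadj : H.Adj i j
  · exact (he i j hadj).ne hij
  · obtain ⟨-, k, h1, l, h2, h3⟩ := hH i j hne hadj
    exact h.not_triangle (he _ _ h1) (he _ _ h2) (hij ▸ (he _ _ h3).symm)

theorem ofEdges_hom {n : ℕ} {E : List (Fin n × Fin n)} {e : Fin n → V}
    (he : ∀ d ∈ E, G.Adj (e d.1) (e d.2)) (i j : Fin n) (hij : (ofEdges E).Adj i j) :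
    G.Adj (e i) (e j) := by
  rcases hij with ⟨-, hij | hij⟩
  exacts [he _ hij, (he _ hij).symm]

/-- The homomorphism is injective, hence bijective by cardinality. An extra edge in `G` would close
a walk of length two into a triangle, so it is an isomorphism, and the indicator of an induced path
becomes a binary code. -/
theorem IsTight.false_of_noPathCode [Fintype V] (h : G.IsTight) {n : ℕ}
    {H : SimpleGraph (Fin n)} [DecidableRel H.Adj] (hH : H.PentagonRich) {e : Fin n → V}
    (he : ∀ i j, H.Adj i j → G.Adj (e i) (e j)) (hV : Fintype.card V ≤ n) {x y z : Fin n}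
    (hxy : x ≠ y) (hyz : y ≠ z) (hxz : x ≠ z) (hno : ∀ m < 2 ^ n, ¬ IsPathCode H x y z m) :
    False := by
  classical
  have hinj := h.hom_injective hH he
  have hbij : Function.Bijective e := (Fintype.bijective_iff_injective_and_card e).2
    ⟨hinj, le_antisymm (Fintype.card_le_of_injective e hinj) (by simpa using hV)⟩
  have hadj : ∀ i j, G.Adj (e i) (e j) ↔ H.Adj i j := by
    refine fun i j => ⟨fun hG => ?_, he i j⟩
    by_contra hn
    obtain ⟨⟨k, h1, h2⟩, -⟩ := hH i j (fun e => hG.ne (by rw [e])) hn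
    exact h.not_triangle (he _ _ h1) (he _ _ h2) hG
  obtain ⟨σ, h1, h2, h3, h4, h5, h6, h7, h8, h9⟩ := (h.onPath (hinj.ne hxy) (hinj.ne hyz)
    (hinj.ne hxz)).indicator (hinj.ne hxy) (hinj.ne hyz) (hinj.ne hxz)
  set m := Nat.ofBits (fun i : Fin n => decide (σ (e i) = 1)) with hm
  have hbit : ∀ i : Fin n, m.testBit i = true ↔ σ (e i) = 1 := fun i => by
    rw [hm, Nat.testBit_ofBits_lt _ _ i.2]; simp
  have hdeg : ∀ i, codeDegree H m i = ∑ s ∈ G.neighborFinset (e i), σ s := by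
    intro i
    have e1 : ∑ s ∈ G.neighborFinset (e i), σ s = ∑ s, if G.Adj (e i) s then σ s else 0 := by
      rw [neighborFinset_eq_filter, Finset.sum_filter]
    rw [e1, ← hbij.sum_comp, codeDegree, List.countP_eq_length_filter, ← List.sum_ofFn,
      List.ofFn_eq_map]
    induction List.finRange n with
    | nil => rfl
    | cons j l ih =>
      rw [List.map_cons, List.sum_cons, ← ih, List.filter_cons]
      have hb := hbit j
      have := h1 (e j)
      by_cases hj : G.Adj (e i) (e j) <;> by_cases hs : σ (e j) = 1
      · simp [hb.2 hs, hj, (hadj i j).1 hj, hs, add_comm]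
      · have : σ (e j) = 0 := by omega
        simp [hj, (hadj i j).1 hj, this, Bool.eq_false_iff.2 (mt hb.1 hs)]
      · simp [hj, mt (hadj i j).2 hj]
      · simp [hj, mt (hadj i j).2 hj]
  refine hno m (Nat.ofBits_lt_two_pow _) ⟨⟨(hbit x).2 h2, (hbit y).2 h3, (hbit z).2 h4⟩,
    ⟨?_, ?_, ?_, ?_⟩, fun t ⟨hx, hy, hz, ht⟩ => ?_⟩
  · rwa [hdeg]
  · rwa [hdeg]
  · rwa [hdeg]
  · rwa [hdeg, hdeg, hdeg]
  · rw [hdeg]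
    exact h9 _ (hinj.ne hx) (hinj.ne hy) (hinj.ne hz) ((hbit t).1 ht)

/-- A cubic vertex with two further common neighbours of its neighbours, a private neighbour of
each of the outer two, and one of the middle one.
The vertices are numbered `v a b c p q x z r`. -/
def frameEdges : List (Fin 9 × Fin 9) :=
  [(0, 1), (0, 2), (0, 3), (4, 1), (4, 2), (5, 2), (5, 3), (4, 7), (5, 6), (6, 1), (7, 3), (8, 2),
    (6, 8), (8, 7)]

theorem frameEdges_pentagonRich : (ofEdges frameEdges).PentagonRich := by
  decide +kernel

/-- The obstructing triple is `v`, `p`, `x`. -/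
theorem frameEdges_noPathCode : ∀ m < 2 ^ 9, ¬ IsPathCode (ofEdges frameEdges) 0 4 6 m := by
  decide +kernel

/-- The vertices are numbered `v a b c p q x z r y` with `y` a second private neighbour of `a`. -/
def outerEdges : List (Fin 10 × Fin 10) :=
  [(0, 1), (0, 2), (0, 3), (4, 1), (4, 2), (5, 2), (5, 3), (4, 7), (5, 6), (6, 1), (7, 3), (8, 2),
    (6, 8), (8, 7), (9, 1), (9, 5), (9, 7)]

theorem outerEdges_pentagonRich : (ofEdges outerEdges).PentagonRich := by
  decide +kernel

theorem outerEdges_noPathCode : ∀ m < 2 ^ 10, ¬ IsPathCode (ofEdges outerEdges) 0 4 6 m := by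
  decide +kernel

/-- The vertices are numbered `v a b c p q x z r s` with `s` a common neighbour of `a`, `c`;
the private neighbours form a path with centre `r`. -/
def middleEdges : List (Fin 10 × Fin 10) :=
  [(0, 1), (0, 2), (0, 3), (4, 1), (4, 2), (5, 2), (5, 3), (4, 7), (5, 6), (6, 1), (7, 3), (8, 2),
    (9, 1), (9, 3), (9, 8), (6, 8), (8, 7)]

theorem middleEdges_pentagonRich : (ofEdges middleEdges).PentagonRich := by
  decide +kernel

theorem middleEdges_noPathCode : ∀ m < 2 ^ 10, ¬ IsPathCode (ofEdges middleEdges) 0 4 6 m := by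
  decide +kernel

/-- As `middleEdges`, but with centre `x`. -/
def sideEdges : List (Fin 10 × Fin 10) :=
  [(0, 1), (0, 2), (0, 3), (4, 1), (4, 2), (5, 2), (5, 3), (4, 7), (5, 6), (6, 1), (7, 3), (8, 2),
    (9, 1), (9, 3), (9, 8), (6, 8), (6, 7)]

theorem sideEdges_pentagonRich : (ofEdges sideEdges).PentagonRich := by
  decide +kernel

/-- Here the obstructing triple is `v`, `p`, `r`. -/
theorem sideEdges_noPathCode : ∀ m < 2 ^ 10, ¬ IsPathCode (ofEdges sideEdges) 0 4 8 m := by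
  decide +kernel

/-! ### Cubic frames -/

/-- `v` has exactly the three neighbours `a`, `b`, `c`, and besides `v` there are a common
neighbour `p` of `a`, `b` only and a common neighbour `q` of `b`, `c` only. -/
structure CubicFrame (G : SimpleGraph V) (v a b c p q : V) : Prop where
  nbr : ∀ t, G.Adj v t ↔ t = a ∨ t = b ∨ t = c
  pv : p ≠ v
  pa : G.Adj p a
  pb : G.Adj p b
  pc : ¬ G.Adj p c
  qv : q ≠ v
  qb : G.Adj q b
  qc : G.Adj q c
  qa : ¬ G.Adj q a

/-- Among `a`, `b`, `c`, only `a` is adjacent to `t`. -/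
def OnlyNbr (G : SimpleGraph V) (v a b c t : V) : Prop :=
  t ≠ v ∧ G.Adj t a ∧ ¬ G.Adj t b ∧ ¬ G.Adj t c

theorem CubicFrame.symm {v a b c p q : V} (hf : G.CubicFrame v a b c p q) :
    G.CubicFrame v c b a q p :=
  ⟨fun t => by rw [hf.nbr]; tauto, hf.qv, hf.qc, hf.qb, hf.qa, hf.pv, hf.pb, hf.pa, hf.pc⟩

theorem OnlyNbr.symm {v a b c t : V} (h : G.OnlyNbr v a b c t) : G.OnlyNbr v a c b t :=
  ⟨h.1, h.2.1, h.2.2.2, h.2.2.1⟩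

section

variable {v a b c : V}

/-- Triangle-freeness leaves no other neighbours. Conversely, if `t` were private to `c` and not
adjacent to `p`, a common neighbour of the two would be adjacent to `a`, `b` or `c`, closing a
triangle. The resulting neighbourhood is the same for every such `p`. -/
theorem IsTight.nbr_of_adj_two (h : G.IsTight) (hv : ∀ t, G.Adj v t ↔ t = a ∨ t = b ∨ t = c)
    {p : V} (hpv : p ≠ v) (pa : G.Adj p a) (pb : G.Adj p b) (pc : ¬ G.Adj p c) (t : V) :
    G.Adj p t ↔ t = a ∨ t = b ∨ G.OnlyNbr v c a b t := by
  have nt : ∀ {x y z : V}, G.Adj x y → G.Adj y z → ¬ G.Adj x z :=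
    fun h1 h2 h3 => h.not_triangle h1 h2 h3
  have va : G.Adj v a := (hv a).2 (by simp)
  have vb : G.Adj v b := (hv b).2 (by simp)
  have vc : G.Adj v c := (hv c).2 (by simp)
  have vp : ¬ G.Adj v p := fun hvp => nt hvp pa va
  constructor
  · intro hpt
    by_cases ta : t = a
    · exact Or.inl ta
    by_cases tb : t = b
    · exact Or.inr (Or.inl tb)
    have tv : t ≠ v := by rintro rfl; exact vp hpt.symm
    have tc : t ≠ c := by rintro rfl; exact pc hpt
    have n1 : ¬ G.Adj t a := fun hh => nt hpt hh pa
    have n2 : ¬ G.Adj t b := fun hh => nt hpt hh pb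
    rcases h.exists_common_nbr hv tv ta tb tc with hh | hh | hh
    exacts [(n1 hh).elim, (n2 hh).elim, Or.inr (Or.inr ⟨tv, hh, n1, n2⟩)]
  · rintro (rfl | rfl | ⟨tv, tc, ta, tb⟩)
    · exact pa
    · exact pb
    by_contra hpt
    have hne : p ≠ t := by rintro rfl; exact ta pa
    obtain ⟨s, h1, h2⟩ := h.nbrs p t hne hpt
    have sv : s ≠ v := by rintro rfl; exact vp h1.symm
    have sa : s ≠ a := by rintro rfl; exact ta h2.symm
    have sb : s ≠ b := by rintro rfl; exact tb h2.symm
    have sc : s ≠ c := by rintro rfl; exact pc h1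
    rcases h.exists_common_nbr hv sv sa sb sc with hh | hh | hh
    exacts [nt h1 hh pa, nt h1 hh pb, nt h2.symm hh tc]

/-- Such a `t` would be a twin of `v`. -/
theorem IsTight.not_adj_three [Fintype V] (h : G.IsTight) (hV : 4 < Fintype.card V)
    (hv : ∀ t, G.Adj v t ↔ t = a ∨ t = b ∨ t = c) {t : V} (htv : t ≠ v) (ta : G.Adj t a)
    (tb : G.Adj t b) (tc : G.Adj t c) : False := by
  have nt : ∀ {x y z : V}, G.Adj x y → G.Adj y z → ¬ G.Adj x z :=
    fun h1 h2 h3 => h.not_triangle h1 h2 h3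
  refine h.not_twins hV htv fun s => ⟨fun hs => ?_, fun hs => ?_⟩
  · by_contra hvs
    have hs' := mt (hv s).2 hvs
    push Not at hs'
    have sv : s ≠ v := by
      rintro rfl
      rcases (hv t).1 hs.symm with rfl | rfl | rfl
      exacts [G.irrefl ta, G.irrefl tb, G.irrefl tc]
    rcases h.exists_common_nbr hv sv hs'.1 hs'.2.1 hs'.2.2 with hh | hh | hh
    exacts [nt hs hh ta, nt hs hh tb, nt hs hh tc]
  · rcases (hv s).1 hs with rfl | rfl | rfl <;> assumption

theorem IsTight.eq_of_adj_two [Fintype V] (h : G.IsTight) (hV : 4 < Fintype.card V)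
    (hv : ∀ t, G.Adj v t ↔ t = a ∨ t = b ∨ t = c) {p t : V} (hpv : p ≠ v) (pa : G.Adj p a)
    (pb : G.Adj p b) (htv : t ≠ v) (ta : G.Adj t a) (tb : G.Adj t b) : t = p := by
  have pc : ¬ G.Adj p c := fun hh => h.not_adj_three hV hv hpv pa pb hh
  have tc : ¬ G.Adj t c := fun hh => h.not_adj_three hV hv htv ta tb hh
  by_contra hne
  exact h.not_twins hV hne fun s => by
    rw [h.nbr_of_adj_two hv htv ta tb tc, h.nbr_of_adj_two hv hpv pa pb pc]

variable {p q : V}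

/-- Every vertex outside a cubic frame is of one of four types. -/
theorem IsTight.frame_cases [Fintype V] (h : G.IsTight) (hV : 4 < Fintype.card V)
    (hf : G.CubicFrame v a b c p q) (t : V) :
    t = v ∨ t = a ∨ t = b ∨ t = c ∨ t = p ∨ t = q ∨ G.OnlyNbr v a b c t ∨ G.OnlyNbr v b a c t ∨
      G.OnlyNbr v c a b t ∨ (t ≠ v ∧ G.Adj t a ∧ G.Adj t c ∧ ¬ G.Adj t b) := by
  by_cases tv : t = v
  · exact Or.inl tv
  by_cases ta : t = a
  · exact Or.inr (Or.inl ta)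
  by_cases tb : t = b
  · exact Or.inr (Or.inr (Or.inl tb))
  by_cases tc : t = c
  · exact Or.inr (Or.inr (Or.inr (Or.inl tc)))
  have h0 := h.exists_common_nbr hf.nbr tv ta tb tc
  have h1 : G.Adj t a → G.Adj t b → t = p := fun h1 h2 =>
    h.eq_of_adj_two hV hf.nbr hf.pv hf.pa hf.pb tv h1 h2
  have h2 : G.Adj t b → G.Adj t c → t = q := fun h1 h2 =>
    h.eq_of_adj_two hV hf.symm.nbr hf.qv hf.qc hf.qb tv h2 h1
  unfold OnlyNbr
  tauto

end

section

variable {v a b c p q x z r : V}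

theorem IsTight.frame_adj_p (h : G.IsTight) (hf : G.CubicFrame v a b c p q) (t : V) :
    G.Adj p t ↔ t = a ∨ t = b ∨ G.OnlyNbr v c a b t :=
  h.nbr_of_adj_two hf.nbr hf.pv hf.pa hf.pb hf.pc t

theorem IsTight.frame_adj_q (h : G.IsTight) (hf : G.CubicFrame v a b c p q) (t : V) :
    G.Adj q t ↔ t = c ∨ t = b ∨ G.OnlyNbr v a c b t :=
  h.nbr_of_adj_two hf.symm.nbr hf.qv hf.qc hf.qb hf.qa t

theorem IsTight.frame_not_nbr (h : G.IsTight) (hf : G.CubicFrame v a b c p q) :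
    ¬ G.Adj a b ∧ ¬ G.Adj b c ∧ ¬ G.Adj a c := by
  have va : G.Adj v a := (hf.nbr a).2 (by simp)
  have vb : G.Adj v b := (hf.nbr b).2 (by simp)
  have vc : G.Adj v c := (hf.nbr c).2 (by simp)
  exact ⟨fun hh => h.not_triangle va hh vb, fun hh => h.not_triangle vb hh vc,
    fun hh => h.not_triangle va hh vc⟩

/-- The frame graph plus one more private neighbour of `a` is not tight. -/
theorem IsTight.no_outer [Fintype V] (h : G.IsTight) (hV : 4 < Fintype.card V)
    (hV' : Fintype.card V ≤ 10) (hf : G.CubicFrame v a b c p q) (hx : G.OnlyNbr v a b c x) (hz : G.OnlyNbr v c a b z)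
    (hr : G.OnlyNbr v b a c r) (xr : G.Adj x r) (rz : G.Adj r z) {y : V}
    (hy : G.OnlyNbr v a b c y) (hyx : y ≠ x)
    (hall : ∀ t, t = y ∨ t ∈ [v, a, b, c, p, q, x, z, r]) : False := by
  have nt : ∀ {x y z : V}, G.Adj x y → G.Adj y z → ¬ G.Adj x z :=
    fun h1 h2 h3 => h.not_triangle h1 h2 h3
  have va : G.Adj v a := (hf.nbr a).2 (by simp)
  have vb : G.Adj v b := (hf.nbr b).2 (by simp)
  have vc : G.Adj v c := (hf.nbr c).2 (by simp)
  have qx : G.Adj q x := (h.frame_adj_q hf x).2 (Or.inr (Or.inr hx.symm))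
  have qy : G.Adj q y := (h.frame_adj_q hf y).2 (Or.inr (Or.inr hy.symm))
  have pz : G.Adj p z := (h.frame_adj_p hf z).2 (Or.inr (Or.inr hz))
  by_cases yz : G.Adj y z
  · refine h.false_of_noPathCode outerEdges_pentagonRich
      (ofEdges_hom (e := ![v, a, b, c, p, q, x, z, r, y]) ?_) hV' (x := 0) (y := 4) (z := 6)
      (by decide) (by decide) (by decide) outerEdges_noPathCode
    simp only [outerEdges, List.forall_mem_cons, List.not_mem_nil, false_imp_iff, implies_true,
      and_true]
    exact ⟨va, vb, vc, hf.pa, hf.pb, hf.qb, hf.qc, pz, qx, hx.2.1, hz.2.1, hr.2.1, xr, rz,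
      hy.2.1, qy.symm, yz⟩
  -- If `y` is not adjacent to `z`, their common neighbour can only be `r`; then `x` and `y` both
  -- have neighbourhood `{a, q, r}`.
  · have vy : ¬ G.Adj v y := fun hh => nt hh hy.2.1 va
    have yr : G.Adj y r := by
      have hne : y ≠ z := by rintro rfl; exact hz.2.2.1 hy.2.1
      obtain ⟨u, h1, h2⟩ := h.nbrs y z hne yz
      rcases hall u with rfl | hu
      · exact (G.irrefl h1).elim
      simp only [List.mem_cons, List.not_mem_nil, or_false] at hu
      rcases hu with rfl | rfl | rfl | rfl | rfl | rfl | rfl | rfl | rfl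
      · exact (vy h1.symm).elim
      · exact (hz.2.2.1 h2.symm).elim
      · exact (hy.2.2.1 h1).elim
      · exact (hy.2.2.2 h1).elim
      · exact (nt h1 hf.pa hy.2.1).elim
      · exact (nt h2.symm hf.qc hz.2.1).elim
      · exact (nt h1 hx.2.1 hy.2.1).elim
      · exact (G.irrefl h2).elim
      · exact h1
    have nb : ∀ w, G.OnlyNbr v a b c w → G.Adj w r → ¬ G.Adj w z →
        ∀ t, G.Adj w t ↔ t = a ∨ t = q ∨ t = r := by
      intro w hw wr wz t
      constructor
      · intro hwt
        rcases hall t with rfl | hu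
        · exact (nt hwt hy.2.1 hw.2.1).elim
        simp only [List.mem_cons, List.not_mem_nil, or_false] at hu
        rcases hu with rfl | rfl | rfl | rfl | rfl | rfl | rfl | rfl | rfl
        · exact (nt hwt va hw.2.1).elim
        · simp
        · exact (hw.2.2.1 hwt).elim
        · exact (hw.2.2.2 hwt).elim
        · exact (nt hwt hf.pa hw.2.1).elim
        · simp
        · exact (nt hwt hx.2.1 hw.2.1).elim
        · exact (wz hwt).elim
        · simp
      · rintro (rfl | rfl | rfl)
        · exact hw.2.1
        · exact ((h.frame_adj_q hf w).2 (Or.inr (Or.inr hw.symm))).symm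
        · exact wr
    exact h.not_twins hV hyx fun t => by
      rw [nb y hy yr yz, nb x hx xr (nt xr rz)]

/-- The frame graph plus one more private neighbour of `b` is not tight. -/
theorem IsTight.no_inner [Fintype V] (h : G.IsTight) (hV : 4 < Fintype.card V)
    (hf : G.CubicFrame v a b c p q) (hx : G.OnlyNbr v a b c x) (hz : G.OnlyNbr v c a b z)
    (hr : G.OnlyNbr v b a c r) (xr : G.Adj x r) (rz : G.Adj r z) {y : V}
    (hy : G.OnlyNbr v b a c y) (hyr : y ≠ r) (yx : G.Adj y x) (yz : G.Adj y z)
    (hall : ∀ t, t = y ∨ t ∈ [v, a, b, c, p, q, x, z, r]) : False := by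
  have nt : ∀ {x y z : V}, G.Adj x y → G.Adj y z → ¬ G.Adj x z :=
    fun h1 h2 h3 => h.not_triangle h1 h2 h3
  have vb : G.Adj v b := (hf.nbr b).2 (by simp)
  -- Both `y` and `r` qualify as `w`, which makes them twins.
  have nb : ∀ w, G.OnlyNbr v b a c w → G.Adj w x → G.Adj w z →
      ∀ t, G.Adj w t ↔ t = b ∨ t = x ∨ t = z := by
    intro w hw wx wz t
    constructor
    · intro hwt
      rcases hall t with rfl | hu
      · exact (nt hwt hy.2.1 hw.2.1).elim
      simp only [List.mem_cons, List.not_mem_nil, or_false] at hu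
      rcases hu with rfl | rfl | rfl | rfl | rfl | rfl | rfl | rfl | rfl
      · exact (nt hwt vb hw.2.1).elim
      · exact (hw.2.2.1 hwt).elim
      · simp
      · exact (hw.2.2.2 hwt).elim
      · exact (nt hwt hf.pb hw.2.1).elim
      · exact (nt hwt hf.qb hw.2.1).elim
      · simp
      · simp
      · exact (nt hwt hr.2.1 hw.2.1).elim
    · rintro (rfl | rfl | rfl)
      · exact hw.2.1
      · exact wx
      · exact wz
  exact h.not_twins hV hyr fun t => by rw [nb y hy yx yz, nb r hr xr.symm rz]

/-- A tight graph with a cubic frame and no private neighbour of `b` has eight vertices. -/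
theorem IsTight.exists_inner [Fintype V] (h : G.IsTight) (hV : 8 < Fintype.card V)
    (hf : G.CubicFrame v a b c p q) (hx : G.OnlyNbr v a b c x) (hz : G.OnlyNbr v c a b z) :
    ∃ r, G.OnlyNbr v b a c r := by
  by_contra! hno
  have hV4 : 4 < Fintype.card V := by omega
  have nt : ∀ {x y z : V}, G.Adj x y → G.Adj y z → ¬ G.Adj x z :=
    fun h1 h2 h3 => h.not_triangle h1 h2 h3
  obtain ⟨nab, nbc, nac⟩ := h.frame_not_nbr hf
  have va : G.Adj v a := (hf.nbr a).2 (by simp)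
  have vc : G.Adj v c := (hf.nbr c).2 (by simp)
  -- With no private neighbour of `b`, nothing can be a common neighbour of `t` and `t'`. Private
  -- neighbours of `a` and of `c` are thus completely joined, and those of one kind are twins.
  have complete : ∀ t t', G.OnlyNbr v a b c t → G.OnlyNbr v c a b t' → G.Adj t t' := by
    intro t t' ht ht'
    by_contra hn
    have hne : t ≠ t' := by rintro rfl; exact ht'.2.2.1 ht.2.1
    obtain ⟨s, h1, h2⟩ := h.nbrs t t' hne hn
    rcases h.frame_cases hV4 hf s with rfl | rfl | rfl | rfl | rfl | rfl | hs | hs | hs | hs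
    · exact nt h1 va ht.2.1
    · exact ht'.2.2.1 h2.symm
    · exact ht.2.2.1 h1
    · exact ht.2.2.2 h1
    · exact nt h1 hf.pa ht.2.1
    · exact nt h2.symm hf.qc ht'.2.1
    · exact nt h1 hs.2.1 ht.2.1
    · exact hno s hs
    · exact nt h2.symm hs.2.1 ht'.2.1
    · exact nt h1 hs.2.1 ht.2.1
  have nba : ∀ t, G.OnlyNbr v a b c t → ∀ s, G.Adj t s ↔ s = a ∨ s = q ∨ G.OnlyNbr v c a b s := by
    intro t ht s
    constructor
    · intro hts
      rcases h.frame_cases hV4 hf s with rfl | rfl | rfl | rfl | rfl | rfl | hs | hs | hs | hs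
      · exact (nt hts va ht.2.1).elim
      · simp
      · exact (ht.2.2.1 hts).elim
      · exact (ht.2.2.2 hts).elim
      · exact (nt hts hf.pa ht.2.1).elim
      · simp
      · exact (nt hts hs.2.1 ht.2.1).elim
      · exact (hno s hs).elim
      · exact Or.inr (Or.inr hs)
      · exact (nt hts hs.2.1 ht.2.1).elim
    · rintro (rfl | rfl | hs)
      · exact ht.2.1
      · exact ((h.frame_adj_q hf t).2 (Or.inr (Or.inr ht.symm))).symm
      · exact complete t s ht hs
  have nbc : ∀ t, G.OnlyNbr v c a b t → ∀ s, G.Adj t s ↔ s = c ∨ s = p ∨ G.OnlyNbr v a b c s := by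
    intro t ht s
    constructor
    · intro hts
      rcases h.frame_cases hV4 hf s with rfl | rfl | rfl | rfl | rfl | rfl | hs | hs | hs | hs
      · exact (nt hts vc ht.2.1).elim
      · exact (ht.2.2.1 hts).elim
      · exact (ht.2.2.2 hts).elim
      · simp
      · simp
      · exact (nt hts hf.qc ht.2.1).elim
      · exact Or.inr (Or.inr hs)
      · exact (hno s hs).elim
      · exact (nt hts hs.2.1 ht.2.1).elim
      · exact (nt hts hs.2.2.1 ht.2.1).elim
    · rintro (rfl | rfl | hs)
      · exact ht.2.1
      · exact ((h.frame_adj_p hf t).2 (Or.inr (Or.inr ht))).symm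
      · exact (complete s t hs ht).symm
  obtain ⟨t, ht⟩ := exists_notMem_of_card hV [v, a, b, c, p, q, x, z] (by simp)
  simp only [List.mem_cons, List.not_mem_nil, or_false, not_or] at ht
  obtain ⟨h1, h2, h3, h4, h5, h6, h7, h8⟩ := ht
  rcases h.frame_cases hV4 hf t with e | e | e | e | e | e | hs | hs | hs | hs
  · exact h1 e
  · exact h2 e
  · exact h3 e
  · exact h4 e
  · exact h5 e
  · exact h6 e
  · exact h.not_twins hV4 h7 fun s => by rw [nba t hs, nba x hx]
  · exact hno t hs
  · exact h.not_twins hV4 h8 fun s => by rw [nbc t hs, nbc z hz]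
  -- The third neighbour of a common neighbour of `a` and `c` would be private to `b`.
  · obtain ⟨s, s1, s2, s3⟩ := h.exists_adj_notMem_two (by omega) t a c
    rcases (h.nbr_of_adj_two (a := a) (b := c) (c := b) (fun u => by rw [hf.nbr]; tauto) hs.1
      hs.2.1 hs.2.2.1 hs.2.2.2 s).1 s1 with e | e | e
    exacts [s2 e, s3 e, hno s e]

end

section

variable {v a b c p q : V}

/-- No tight graph with nine or ten vertices has a cubic frame. -/
theorem IsTight.card_eq_eight_of_frame [Fintype V] (h : G.IsTight) (hV : 5 < Fintype.card V)
    (hV' : Fintype.card V ≤ 10) (hf : G.CubicFrame v a b c p q) : Fintype.card V = 8 := by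
  have hV4 : 4 < Fintype.card V := by omega
  have nt : ∀ {x y z : V}, G.Adj x y → G.Adj y z → ¬ G.Adj x z :=
    fun h1 h2 h3 => h.not_triangle h1 h2 h3
  obtain ⟨nab, nbc, nac⟩ := h.frame_not_nbr hf
  have va : G.Adj v a := (hf.nbr a).2 (by simp)
  have vb : G.Adj v b := (hf.nbr b).2 (by simp)
  have vc : G.Adj v c := (hf.nbr c).2 (by simp)
  -- Third neighbours of `p` and `q` supply the seventh and eighth vertices.
  obtain ⟨z, pz, za, zb⟩ := h.exists_adj_notMem_two hV p a b
  obtain ⟨x, qx, xc, xb⟩ := h.exists_adj_notMem_two hV q c b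
  have hz : G.OnlyNbr v c a b z := by
    rcases (h.frame_adj_p hf z).1 pz with e | e | e
    exacts [(za e).elim, (zb e).elim, e]
  have hx : G.OnlyNbr v a b c x := by
    rcases (h.frame_adj_q hf x).1 qx with e | e | e
    exacts [(xc e).elim, (xb e).elim, e.symm]
  have hnd : [v, a, b, c, p, q, x, z].Nodup := by
    have := hf.pv
    have := hf.qv
    have := hf.pa
    have := hf.pb
    have := hf.pc
    have := hf.qa
    have := hf.qb
    have := hf.qc
    obtain ⟨_, _, _, _⟩ := hx
    obtain ⟨_, _, _, _⟩ := hz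
    have h1 : a ≠ b := by rintro rfl; contradiction
    have h2 : b ≠ c := by rintro rfl; contradiction
    have h3 : a ≠ c := by rintro rfl; contradiction
    have h4 : p ≠ q := by rintro rfl; contradiction
    have h5 : p ≠ x := by rintro rfl; contradiction
    have h6 : p ≠ z := by rintro rfl; contradiction
    have h7 : q ≠ x := by rintro rfl; contradiction
    have h8 : q ≠ z := by rintro rfl; contradiction
    have h9 : x ≠ z := by rintro rfl; contradiction
    have out : ∀ d, G.Adj v d → ∀ t, t ≠ v → G.Adj t a ∨ G.Adj t b ∨ G.Adj t c → d ≠ t := by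
      rintro d hd t - ht rfl
      rcases ht with ht | ht | ht
      exacts [nt hd ht va, nt hd ht vb, nt hd ht vc]
    have oa := out a va
    have ob := out b vb
    have oc := out c vc
    simp only [List.nodup_cons, List.mem_cons, List.not_mem_nil, or_false, not_or, not_false_iff,
      List.nodup_nil, and_true]
    refine ⟨⟨va.ne, vb.ne, vc.ne, ?_, ?_, ?_, ?_⟩, ⟨h1, h3, ?_, ?_, ?_, ?_⟩, ⟨h2, ?_, ?_, ?_, ?_⟩,
      ⟨?_, ?_, ?_, ?_⟩, ⟨h4, h5, h6⟩, ⟨h7, h8⟩, h9⟩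
    all_goals first
      | exact Ne.symm ‹_›
      | exact oa _ ‹_› (by tauto)
      | exact ob _ ‹_› (by tauto)
      | exact oc _ ‹_› (by tauto)
  have h8 := hnd.length_le_card
  simp only [List.length_cons, List.length_nil] at h8
  by_contra hne
  have hV8 : 8 < Fintype.card V := by omega
  obtain ⟨r, hr⟩ := h.exists_inner hV8 hf hx hz
  have nvr : ¬ G.Adj v r := fun hh => nt hh hr.2.1 vb
  -- A common neighbour `s` of `a` and `c` is adjacent to `r` and completes a ten-vertex graph. Its
  -- shape depends on whether `r` is adjacent to both `x` and `z`; if not, one of these is replaced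
  -- by a vertex giving `sideEdges`, up to swapping `a` and `c`.
  by_cases hs : ∃ s, s ≠ v ∧ G.Adj s a ∧ G.Adj s c ∧ ¬ G.Adj s b
  · obtain ⟨s, sv, sa, sc, sb⟩ := hs
    have sr : G.Adj s r := (h.nbr_of_adj_two (a := a) (b := c) (c := b)
      (fun u => by rw [hf.nbr]; tauto) sv sa sc sb r).2
      (Or.inr (Or.inr ⟨hr.1, hr.2.1, hr.2.2.1, hr.2.2.2⟩))
    by_cases xr : G.Adj x r
    · by_cases rz : G.Adj r z
      · refine h.false_of_noPathCode middleEdges_pentagonRich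
          (ofEdges_hom (e := ![v, a, b, c, p, q, x, z, r, s]) ?_) hV' (x := 0) (y := 4) (z := 6)
          (by decide) (by decide) (by decide) middleEdges_noPathCode
        simp only [middleEdges, List.forall_mem_cons, List.not_mem_nil, false_imp_iff,
          implies_true, and_true]
        exact ⟨va, vb, vc, hf.pa, hf.pb, hf.qb, hf.qc, pz, qx, hx.2.1, hz.2.1, hr.2.1, sa, sc, sr,
          xr, rz⟩
      · have hrz : r ≠ z := by rintro rfl; exact hz.2.2.2 hr.2.1
        obtain ⟨u, ru, uz⟩ := h.nbrs r z hrz rz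
        have hu : G.OnlyNbr v a b c u := by
          rcases h.frame_cases hV4 hf u with rfl | rfl | rfl | rfl | rfl | rfl | e | e | e | e
          · exact (nvr ru.symm).elim
          · exact (hr.2.2.1 ru).elim
          · exact (hz.2.2.2 uz.symm).elim
          · exact (hr.2.2.2 ru).elim
          · exact (nt ru hf.pb hr.2.1).elim
          · exact (nt ru hf.qb hr.2.1).elim
          · exact e
          · exact (nt ru e.2.1 hr.2.1).elim
          · exact (nt uz.symm e.2.1 hz.2.1).elim
          · exact (nt uz.symm e.2.2.1 hz.2.1).elim
        have qu : G.Adj q u := (h.frame_adj_q hf u).2 (Or.inr (Or.inr hu.symm))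
        refine h.false_of_noPathCode sideEdges_pentagonRich
          (ofEdges_hom (e := ![v, a, b, c, p, q, u, z, r, s]) ?_) hV' (x := 0) (y := 4) (z := 8)
          (by decide) (by decide) (by decide) sideEdges_noPathCode
        simp only [sideEdges, List.forall_mem_cons, List.not_mem_nil, false_imp_iff,
          implies_true, and_true]
        exact ⟨va, vb, vc, hf.pa, hf.pb, hf.qb, hf.qc, pz, qu, hu.2.1, hz.2.1, hr.2.1, sa, sc, sr,
          ru.symm, uz⟩
    · have hxr : x ≠ r := by rintro rfl; exact hx.2.2.1 hr.2.1
      obtain ⟨u, xu, ur⟩ := h.nbrs x r hxr xr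
      have hu : G.OnlyNbr v c a b u := by
        rcases h.frame_cases hV4 hf u with rfl | rfl | rfl | rfl | rfl | rfl | e | e | e | e
        · exact (nvr ur).elim
        · exact (hr.2.2.1 ur.symm).elim
        · exact (hx.2.2.1 xu).elim
        · exact (hr.2.2.2 ur.symm).elim
        · exact (nt ur.symm hf.pb hr.2.1).elim
        · exact (nt ur.symm hf.qb hr.2.1).elim
        · exact (nt xu e.2.1 hx.2.1).elim
        · exact (nt ur.symm e.2.1 hr.2.1).elim
        · exact e
        · exact (nt xu e.2.1 hx.2.1).elim
      have pu : G.Adj p u := (h.frame_adj_p hf u).2 (Or.inr (Or.inr hu))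
      refine h.false_of_noPathCode sideEdges_pentagonRich
        (ofEdges_hom (e := ![v, c, b, a, q, p, u, x, r, s]) ?_) hV' (x := 0) (y := 4) (z := 8)
        (by decide) (by decide) (by decide) sideEdges_noPathCode
      simp only [sideEdges, List.forall_mem_cons, List.not_mem_nil, false_imp_iff,
        implies_true, and_true]
      exact ⟨vc, vb, va, hf.qc, hf.qb, hf.pb, hf.pa, qx, pu, hu.2.1, hx.2.1, hr.2.1, sc, sa, sr,
        ur, xu.symm⟩
  · -- every private neighbour of `b` has private neighbours of `a` and `c` as neighbours
    have left : ∀ r, G.OnlyNbr v b a c r → ∃ u, G.Adj r u ∧ G.OnlyNbr v a b c u := by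
      intro r hr
      have hra : r ≠ a := by rintro rfl; exact nab hr.2.1
      obtain ⟨u, ru, ua⟩ := h.nbrs r a hra hr.2.2.1
      have uv : u ≠ v := by rintro rfl; exact nt ru vb hr.2.1
      have ub : ¬ G.Adj u b := fun hh => nt ru hh hr.2.1
      exact ⟨u, ru, uv, ua, ub, fun uc => hs ⟨u, uv, ua, uc, ub⟩⟩
    have right : ∀ r, G.OnlyNbr v b a c r → ∃ u, G.Adj r u ∧ G.OnlyNbr v c a b u := by
      intro r hr
      have hrc : r ≠ c := by rintro rfl; exact nbc hr.2.1.symm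
      obtain ⟨u, ru, uc⟩ := h.nbrs r c hrc hr.2.2.2
      have uv : u ≠ v := by rintro rfl; exact nt ru vb hr.2.1
      have ub : ¬ G.Adj u b := fun hh => nt ru hh hr.2.1
      exact ⟨u, ru, uv, uc, fun ua => hs ⟨u, uv, ua, uc, ub⟩, ub⟩
    -- The earlier `x` and `z` need not be adjacent to `r`; they are chosen anew among its
    -- neighbours.
    clear! x z
    obtain ⟨x, xr, hx⟩ := left r hr
    obtain ⟨z, rz, hz⟩ := right r hr
    replace xr := xr.symm
    have qx : G.Adj q x := (h.frame_adj_q hf x).2 (Or.inr (Or.inr hx.symm))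
    have pz : G.Adj p z := (h.frame_adj_p hf z).2 (Or.inr (Or.inr hz))
    have hhom := ofEdges_hom (G := G) (E := frameEdges) (e := ![v, a, b, c, p, q, x, z, r]) (by
      simp only [frameEdges, List.forall_mem_cons, List.not_mem_nil, false_imp_iff,
        implies_true, and_true]
      exact ⟨va, vb, vc, hf.pa, hf.pb, hf.qb, hf.qc, pz, qx, hx.2.1, hz.2.1, hr.2.1, xr, rz⟩)
    have hinj := h.hom_injective frameEdges_pentagonRich hhom
    have hnd9 : [v, a, b, c, p, q, x, z, r].Nodup := by
      have := List.nodup_ofFn.2 hinj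
      simpa [List.ofFn_succ] using this
    by_cases h9 : Fintype.card V ≤ 9
    · exact h.false_of_noPathCode frameEdges_pentagonRich hhom h9 (x := 0) (y := 4) (z := 6)
        (by decide) (by decide) (by decide) frameEdges_noPathCode
    · obtain ⟨y, hy⟩ := exists_notMem_of_card (n := 9) (by omega) [v, a, b, c, p, q, x, z, r]
        (by simp)
      have hall : ∀ t, t = y ∨ t ∈ [v, a, b, c, p, q, x, z, r] := by
        intro t
        by_contra! ht
        have : (t :: y :: [v, a, b, c, p, q, x, z, r]).Nodup :=
          List.nodup_cons.2 ⟨by simpa using ⟨ht.1, by simpa using ht.2⟩,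
            List.nodup_cons.2 ⟨hy, hnd9⟩⟩
        have := this.length_le_card
        simp only [List.length_cons, List.length_nil] at this
        omega
      have hy' := hy
      simp only [List.mem_cons, List.not_mem_nil, or_false, not_or] at hy'
      obtain ⟨y1, y2, y3, y4, y5, y6, y7, y8, y9⟩ := hy'
      rcases h.frame_cases hV4 hf y with e | e | e | e | e | e | e | e | e | e
      · exact y1 e
      · exact y2 e
      · exact y3 e
      · exact y4 e
      · exact y5 e
      · exact y6 e
      · exact h.no_outer hV4 hV' hf hx hz hr xr rz e y7 hall
      -- Since `x` and `z` are the only private neighbours of `a` and `c`, the vertex `y` is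
      -- adjacent to both.
      · have only : ∀ u, G.OnlyNbr v a b c u → u = x := by
          rintro u ⟨_, ua, ub, uc⟩
          rcases hall u with rfl | hu
          · exact (ub e.2.1).elim
          simp only [List.mem_cons, List.not_mem_nil, or_false] at hu
          rcases hu with rfl | rfl | rfl | rfl | rfl | rfl | rfl | rfl | rfl
          exacts [absurd vb ub, absurd ua G.irrefl, absurd ua.symm nab, absurd ua.symm nac,
            absurd hf.pb ub, absurd hf.qb ub, rfl, absurd hz.2.1 uc, absurd hr.2.1 ub]
        have only' : ∀ u, G.OnlyNbr v c a b u → u = z := by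
          rintro u ⟨_, uc, ua, ub⟩
          rcases hall u with rfl | hu
          · exact (ub e.2.1).elim
          simp only [List.mem_cons, List.not_mem_nil, or_false] at hu
          rcases hu with rfl | rfl | rfl | rfl | rfl | rfl | rfl | rfl | rfl
          exacts [absurd vb ub, absurd uc nac, absurd uc nbc, absurd uc G.irrefl,
            absurd hf.pb ub, absurd hf.qb ub, absurd hx.2.1 ua, rfl, absurd hr.2.1 ub]
        obtain ⟨u, yu, hu⟩ := left y e
        obtain ⟨w, yw, hw⟩ := right y e
        rw [only u hu] at yu
        rw [only' w hw] at yw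
        exact h.no_inner hV4 hf hx hz hr xr rz e y9 yu yw hall
      · refine h.no_outer (z := x) hV4 hV' hf.symm hz.symm hx.symm hr.symm
          rz.symm xr.symm e.symm y8 fun t => ?_
        rcases hall t with ht | ht
        · exact Or.inl ht
        · simp only [List.mem_cons, List.not_mem_nil, or_false] at ht ⊢
          tauto
      · exact hs ⟨y, e⟩

open Classical in
/-- A tight graph with more than five vertices has eight or at least eleven vertices. -/
theorem IsTight.card_cases [Fintype V] (h : G.IsTight) (hV : 5 < Fintype.card V) :
    Fintype.card V = 8 ∨ 11 ≤ Fintype.card V := by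
  by_contra! hcon
  have hV' : Fintype.card V ≤ 10 := by omega
  obtain ⟨v, hv⟩ := h.exists_cubic hV hV'
  obtain ⟨a, b, c, hab, hac, hbc, he⟩ := Finset.card_eq_three.1 hv
  have hn : ∀ t, G.Adj v t ↔ t = a ∨ t = b ∨ t = c := fun t => by
    rw [← mem_neighborFinset, he]; simp
  refine hcon.1 ?_
  have key : ∀ {a b c : V}, (∀ t, G.Adj v t ↔ t = a ∨ t = b ∨ t = c) → G.Linked v a b c →
      G.Linked v b c a → Fintype.card V = 8 := by
    rintro a b c hn ⟨p, pv, pa, pb, pc⟩ ⟨q, qv, qb, qc, qa⟩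
    exact h.card_eq_eight_of_frame hV hV' ⟨hn, pv, pa, pb, pc, qv, qb, qc, qa⟩
  rcases h.linked hV' hab hbc hac hn with ⟨h1, h2⟩ | ⟨h1, h2⟩ | ⟨h1, h2⟩
  · exact key hn h1 h2
  · exact key (fun t => by rw [hn]; tauto) h1 h2
  · exact key (fun t => by rw [hn]; tauto) h1 h2

/-! ### Rich graphs have the required properties -/

/-- An induced path with ends `a`, `c` and five vertices, `b` being the third. -/
def ShortLink (G : SimpleGraph V) (a b c : V) : Prop :=
  (∃ p, G.Adj a p ∧ G.Adj p b ∧ ¬ G.Adj p c) ∧ ∃ q, G.Adj b q ∧ G.Adj q c ∧ ¬ G.Adj q a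

/-- An induced path with ends `a`, `c` and six vertices, `b` being the third. -/
def LongLink (G : SimpleGraph V) (a b c : V) : Prop :=
  ∃ p, (G.Adj a p ∧ G.Adj p b ∧ ¬ G.Adj p c) ∧ ∃ q, (G.Adj b q ∧ ¬ G.Adj q c ∧ ¬ G.Adj q a) ∧
    ∃ r, G.Adj q r ∧ G.Adj r c ∧ ¬ G.Adj r a ∧ ¬ G.Adj r p

/-- In some order, the three vertices are on an induced path of five or six vertices. -/
def AnyLink (G : SimpleGraph V) (a b c : V) : Prop :=
  (G.ShortLink a b c ∨ G.ShortLink b c a ∨ G.ShortLink c a b) ∨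
    (G.LongLink a b c ∨ G.LongLink b c a ∨ G.LongLink c a b) ∨
      (G.LongLink c b a ∨ G.LongLink a c b ∨ G.LongLink b a c)

/-- Triangle-free, of diameter at most two, with all independent triples linked. -/
structure IsRich (G : SimpleGraph V) : Prop where
  nbrs : G.CommonNbrs
  triangle : ∀ a b c, G.Adj a b → G.Adj b c → ¬ G.Adj a c
  link : ∀ a b c, a ≠ b → b ≠ c → a ≠ c → ¬ G.Adj a b → ¬ G.Adj b c → ¬ G.Adj a c → G.AnyLink a b c

theorem CoveredBy.rotate {a b c : V} (h : G.CoveredBy a b c) : G.CoveredBy b c a := by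
  obtain ⟨u, v, p, h1, h2, h3, h4, h5⟩ := h
  exact ⟨u, v, p, h1, h2, h4, h5, h3⟩

theorem CoveredBy.swap {a b c : V} (h : G.CoveredBy a b c) : G.CoveredBy b a c := by
  obtain ⟨u, v, p, h1, h2, h3, h4, h5⟩ := h
  exact ⟨u, v, p, h1, h2, h4, h3, h5⟩

/-- A list of vertices in which exactly the consecutive ones are adjacent is an induced path. -/
theorem exists_chordless_of_list (u : V) (l : List V) (hc : List.IsChain G.Adj (u :: l))
    (hn : (u :: l).Nodup)
    (hl : ∀ i j, (hi : i < (u :: l).length) → (hj : j < (u :: l).length) → i + 1 < j →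
      ¬ G.Adj (u :: l)[i] (u :: l)[j]) :
    ∃ v, ∃ p : G.Walk u v, p.IsPath ∧ p.IsChordless ∧ p.support = u :: l := by
  induction l generalizing u with
  | nil =>
    refine ⟨u, .nil, .nil, ?_, rfl⟩
    rw [Walk.isChordless_iff_forall_mem_edges]
    intro x y hx hy hxy
    simp only [Walk.support_nil, List.mem_singleton] at hx hy
    exact absurd (hx.trans hy.symm) hxy.ne
  | cons w l ih =>
    rw [List.isChain_cons_cons] at hc
    rw [List.nodup_cons] at hn
    obtain ⟨v, p, hp, hch, hs⟩ := ih w hc.2 hn.2 fun i j hi hj hij => by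
      have := hl (i + 1) (j + 1) (by simpa using hi) (by simpa using hj) (by omega)
      simpa using this
    obtain ⟨h1, h2⟩ := Walk.cons_chordless hp hch hc.1 (by rw [hs]; exact hn.1) (by
      intro x hx hux
      rw [hs] at hx
      obtain ⟨i, hi, rfl⟩ := List.mem_iff_getElem.1 hx
      by_cases h0 : i = 0
      · subst h0; rfl
      · exact absurd hux (hl 0 (i + 1) (by simp) (by simpa using hi) (by omega)))
    exact ⟨v, _, h1, h2, by rw [Walk.support_cons, hs]⟩

/-- The nonadjacency of `p` and `q`, absent from the definition, holds because `b` is a common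
neighbour. -/
theorem ShortLink.coveredBy {a b c : V} (h : G.ShortLink a b c)
    (ht : ∀ a b c, G.Adj a b → G.Adj b c → ¬ G.Adj a c) (hab : a ≠ b) (hbc : b ≠ c) (hac : a ≠ c)
    (nab : ¬ G.Adj a b) (nbc : ¬ G.Adj b c) (nac : ¬ G.Adj a c) : G.CoveredBy a b c := by
  obtain ⟨⟨p, ap, pb, pc⟩, q, bq, qc, qa⟩ := h
  have pq : ¬ G.Adj p q := ht _ _ _ pb bq
  have hpq : p ≠ q := by rintro rfl; exact pc qc
  have haq : a ≠ q := by rintro rfl; exact nab bq.symm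
  have hpc : p ≠ c := by rintro rfl; exact nac ap
  obtain ⟨v, w, h1, h2, h3⟩ := exists_chordless_of_list (G := G) a [p, b, q, c]
    (by simp [ap, pb, bq, qc])
    (by simp [ap.ne, pb.ne, bq.ne, qc.ne, hab, hbc, hac, hpq, haq, hpc]) (by
      intro i j hi hj hij
      simp only [List.length_cons, List.length_nil] at hi hj
      have qa' := fun h : G.Adj a q => qa h.symm
      interval_cases j <;> interval_cases i <;> first | omega | (simpa using by assumption))
  exact ⟨a, v, w, h1, h2, by simp [h3], by simp [h3], by simp [h3]⟩

theorem LongLink.coveredBy {a b c : V} (h : G.LongLink a b c)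
    (ht : ∀ a b c, G.Adj a b → G.Adj b c → ¬ G.Adj a c) (hab : a ≠ b) (hbc : b ≠ c) (hac : a ≠ c)
    (nab : ¬ G.Adj a b) (nbc : ¬ G.Adj b c) (nac : ¬ G.Adj a c) : G.CoveredBy a b c := by
  obtain ⟨p, ⟨ap, pb, pc⟩, q, ⟨bq, qc, qa⟩, r, qr, rc, ra, rp⟩ := h
  have pq : ¬ G.Adj p q := ht _ _ _ pb bq
  have br : ¬ G.Adj b r := ht _ _ _ bq qr
  have hpq : p ≠ q := by rintro rfl; exact qa ap.symm
  have haq : a ≠ q := by rintro rfl; exact nab bq.symm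
  have hpc : p ≠ c := by rintro rfl; exact nac ap
  have har : a ≠ r := by rintro rfl; exact nac rc
  have hpr : p ≠ r := by rintro rfl; exact pc rc
  have hbr : b ≠ r := by rintro rfl; exact nbc rc
  have hqc : q ≠ c := by rintro rfl; exact nbc bq
  obtain ⟨v, w, h1, h2, h3⟩ := exists_chordless_of_list (G := G) a [p, b, q, r, c]
    (by simp [ap, pb, bq, qr, rc])
    (by simp [ap.ne, pb.ne, bq.ne, qr.ne, rc.ne, hab, hbc, hac, hpq, haq, hpc, har, hpr, hbr,
      hqc]) (by
      intro i j hi hj hij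
      simp only [List.length_cons, List.length_nil] at hi hj
      have qa' := fun h : G.Adj a q => qa h.symm
      have ra' := fun h : G.Adj a r => ra h.symm
      have rp' := fun h : G.Adj p r => rp h.symm
      interval_cases j <;> interval_cases i <;> first | omega | (simpa using by assumption))
  exact ⟨a, v, w, h1, h2, by simp [h3], by simp [h3], by simp [h3]⟩

theorem coveredBy_of_adj_adj {a b c : V} (ab : G.Adj a b) (bc : G.Adj b c)
    (nac : ¬ G.Adj a c) (hac : a ≠ c) : G.CoveredBy a b c := by
  obtain ⟨v, w, h1, h2, h3⟩ := exists_chordless_of_list (G := G) a [b, c]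
    (by simp [ab, bc]) (by simp [ab.ne, bc.ne, hac]) (by
      intro i j hi hj hij
      simp only [List.length_cons, List.length_nil] at hi hj
      interval_cases j <;> interval_cases i <;> first | omega | (simpa using by assumption))
  exact ⟨a, v, w, h1, h2, by simp [h3], by simp [h3], by simp [h3]⟩

/-- If `c` is adjacent to neither `a` nor `b`, a common neighbour `y` of `b` and `c` gives the path
`a b y c`, induced since there are no triangles. So links are needed only for independent triples.
-/
theorem IsRich.coveredBy_of_adj (h : G.IsRich) {a b c : V} (ab : G.Adj a b) (hbc : b ≠ c)
    (hac : a ≠ c) : G.CoveredBy a b c := by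
  by_cases bc : G.Adj b c
  · exact coveredBy_of_adj_adj ab bc (h.triangle _ _ _ ab bc) hac
  by_cases ac : G.Adj a c
  · exact (coveredBy_of_adj_adj ab.symm ac bc hbc).swap
  obtain ⟨y, by', yc⟩ := h.nbrs b c hbc bc
  have ay : ¬ G.Adj a y := h.triangle _ _ _ ab by'
  have hay : a ≠ y := by rintro rfl; exact ac yc
  obtain ⟨v, w, h1, h2, h3⟩ := exists_chordless_of_list (G := G) a [b, y, c]
    (by simp [ab, by', yc]) (by simp [ab.ne, by'.ne, yc.ne, hac, hbc, hay]) (by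
      intro i j hi hj hij
      simp only [List.length_cons, List.length_nil] at hi hj
      interval_cases j <;> interval_cases i <;> first | omega | (simpa using by assumption))
  exact ⟨a, v, w, h1, h2, by simp [h3], by simp [h3], by simp [h3]⟩

theorem IsRich.coveredBy (h : G.IsRich) {a b c : V} (hab : a ≠ b) (hbc : b ≠ c) (hac : a ≠ c) :
    G.CoveredBy a b c := by
  by_cases ab : G.Adj a b
  · exact h.coveredBy_of_adj ab hbc hac
  by_cases bc : G.Adj b c
  · exact (h.coveredBy_of_adj bc hac.symm hab.symm).rotate.rotate
  by_cases ac : G.Adj a c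
  · exact (h.coveredBy_of_adj ac hbc.symm hab).swap.rotate
  have ba := fun h : G.Adj b a => ab h.symm
  have cb := fun h : G.Adj c b => bc h.symm
  have ca := fun h : G.Adj c a => ac h.symm
  have ht := h.triangle
  rcases h.link a b c hab hbc hac ab bc ac with (hl | hl | hl) | (hl | hl | hl) | (hl | hl | hl)
  · exact hl.coveredBy ht hab hbc hac ab bc ac
  · exact (hl.coveredBy ht hbc hac.symm hab.symm bc ca ba).rotate.rotate
  · exact (hl.coveredBy ht hac.symm hab hbc.symm ca ab cb).rotate
  · exact hl.coveredBy ht hab hbc hac ab bc ac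
  · exact (hl.coveredBy ht hbc hac.symm hab.symm bc ca ba).rotate.rotate
  · exact (hl.coveredBy ht hac.symm hab hbc.symm ca ab cb).rotate
  · exact (hl.coveredBy ht hbc.symm hab.symm hac.symm cb ba ca).rotate.swap
  · exact (hl.coveredBy ht hac hbc.symm hab ac cb ab).swap.rotate
  · exact (hl.coveredBy ht hab.symm hac hbc ba ac bc).swap

theorem IsRich.mpNumber_and_ediam [Fintype V] (h : G.IsRich) (hV : 2 < Fintype.card V) :
    G.mpNumber = 2 ∧ G.ediam = 2 := by
  refine ⟨mpNumber_eq_two hV.le fun a b c hab hbc hac => h.coveredBy hab hbc hac, ?_⟩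
  obtain ⟨a, -⟩ := exists_notMem_of_card (V := V) (n := 0) (by omega) [] (by simp)
  obtain ⟨b, hb⟩ := exists_notMem_of_card hV [a] (by simp)
  obtain ⟨c, hc⟩ := exists_notMem_of_card hV [a, b] (by simp)
  simp only [List.mem_cons, List.not_mem_nil, or_false, not_or] at hb hc
  by_cases ab : G.Adj a b
  · by_cases bc : G.Adj b c
    · exact ediam_eq_two h.nbrs (Ne.symm hc.1) (h.triangle _ _ _ ab bc)
    · exact ediam_eq_two h.nbrs (Ne.symm hc.2) bc
  · exact ediam_eq_two h.nbrs (Ne.symm hb) ab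

theorem AnyLink.map {W : Type*} {H : SimpleGraph W} (f : H ↪g G) {a b c : W}
    (h : H.AnyLink a b c) : G.AnyLink (f a) (f b) (f c) := by
  have hs : ∀ {a b c}, H.ShortLink a b c → G.ShortLink (f a) (f b) (f c) := by
    rintro a b c ⟨⟨p, hp⟩, q, hq⟩
    exact ⟨⟨f p, by simpa using hp⟩, f q, by simpa using hq⟩
  have hl : ∀ {a b c}, H.LongLink a b c → G.LongLink (f a) (f b) (f c) := by
    rintro a b c ⟨p, hp, q, hq, r, hr⟩
    exact ⟨f p, by simpa using hp, f q, by simpa using hq, f r, by simpa using hr⟩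
  exact h.imp (Or.imp hs (Or.imp hs hs))
    (Or.imp (Or.imp hl (Or.imp hl hl)) (Or.imp hl (Or.imp hl hl)))

/-- Richness only depends on how any three vertices sit in the graph. -/
theorem IsRich.of_embeddings {W : Type*} {H : SimpleGraph W} (h : H.IsRich)
    (hf : ∀ a b c : V, ∃ f : H ↪g G, a ∈ Set.range f ∧ b ∈ Set.range f ∧ c ∈ Set.range f) :
    G.IsRich := by
  refine ⟨fun a b hab nab => ?_, fun a b c ab bc ac => ?_, fun a b c hab hbc hac ab bc ac => ?_⟩
  · obtain ⟨f, ⟨a, rfl⟩, ⟨b, rfl⟩, -⟩ := hf a b b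
    obtain ⟨c, h1, h2⟩ := h.nbrs a b (fun e => hab (by rw [e])) (by simpa using nab)
    exact ⟨f c, by simpa using h1, by simpa using h2⟩
  · obtain ⟨f, ⟨a, rfl⟩, ⟨b, rfl⟩, ⟨c, rfl⟩⟩ := hf a b c
    exact h.triangle a b c (by simpa using ab) (by simpa using bc) (by simpa using ac)
  · obtain ⟨f, ⟨a, rfl⟩, ⟨b, rfl⟩, ⟨c, rfl⟩⟩ := hf a b c
    exact (h.link a b c (fun e => hab (by rw [e])) (fun e => hbc (by rw [e]))
      (fun e => hac (by rw [e])) (by simpa using ab) (by simpa using bc) (by simpa using ac)).map f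

end

/-! ### Boolean verification of richness -/

/-- The graph on `Fin n` with adjacency given by a Boolean function. -/
def ofBool (A : ℕ → ℕ → Bool) (hs : ∀ x y, A x y = A y x) (hi : ∀ x, A x x = false) (n : ℕ) :
    SimpleGraph (Fin n) where
  Adj x y := A x y = true
  symm := ⟨fun x y h => by rw [hs]; exact h⟩
  loopless := ⟨fun x h => by rw [hi] at h; exact absurd h (by decide)⟩

section

variable (A : ℕ → ℕ → Bool) (n : ℕ)

/-- Boolean form of `ShortLink`. -/
def shortCheck (a b c : ℕ) : Bool :=
  ((List.range n).any fun p => A a p && (A p b && !A p c)) &&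
    (List.range n).any fun q => A b q && (A q c && !A q a)

/-- Boolean form of `LongLink`. -/
def longCheck (a b c : ℕ) : Bool :=
  (List.range n).any fun p => (A a p && (A p b && !A p c)) && (List.range n).any fun q =>
    (A b q && (!A q c && !A q a)) && (List.range n).any fun r =>
      A q r && (A r c && (!A r a && !A r p))

/-- Boolean form of `AnyLink`. -/
def anyCheck (a b c : ℕ) : Bool :=
  (shortCheck A n a b c || (shortCheck A n b c a || shortCheck A n c a b)) ||
    ((longCheck A n a b c || (longCheck A n b c a || longCheck A n c a b)) ||
      (longCheck A n c b a || (longCheck A n a c b || longCheck A n b a c)))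

/-- Boolean form of `IsRich`, on ordered tuples. -/
def richCheck : Bool :=
  (List.range n).all fun a => (List.range a).all fun b =>
    bif A a b then (List.range n).all fun k => !(A a k && A b k)
    else ((List.range n).any fun k => A a k && A k b) &&
      (List.range b).all fun c => A a c || (A b c || anyCheck A n a b c)

variable {A n} {hs : ∀ x y, A x y = A y x} {hi : ∀ x, A x x = false}

theorem shortLink_of_check {a b c : Fin n} (h : shortCheck A n a b c = true) :
    (ofBool A hs hi n).ShortLink a b c := by
  simp only [shortCheck, Bool.and_eq_true, List.any_eq_true, List.mem_range,
    Bool.not_eq_true'] at h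
  obtain ⟨⟨p, hp, h1, h2, h3⟩, q, hq, h4, h5, h6⟩ := h
  exact ⟨⟨⟨p, hp⟩, h1, h2, Bool.eq_false_iff.1 h3⟩, ⟨q, hq⟩, h4, h5, Bool.eq_false_iff.1 h6⟩

theorem longLink_of_check {a b c : Fin n} (h : longCheck A n a b c = true) :
    (ofBool A hs hi n).LongLink a b c := by
  simp only [longCheck, Bool.and_eq_true, List.any_eq_true, List.mem_range,
    Bool.not_eq_true'] at h
  obtain ⟨p, hp, ⟨h1, h2, h3⟩, q, hq, ⟨h4, h5, h6⟩, r, hr, h7, h8, h9, h10⟩ := h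
  exact ⟨⟨p, hp⟩, ⟨h1, h2, Bool.eq_false_iff.1 h3⟩, ⟨q, hq⟩,
    ⟨h4, Bool.eq_false_iff.1 h5, Bool.eq_false_iff.1 h6⟩, ⟨r, hr⟩, h7, h8,
    Bool.eq_false_iff.1 h9, Bool.eq_false_iff.1 h10⟩

theorem anyLink_of_check {a b c : Fin n} (h : anyCheck A n a b c = true) :
    (ofBool A hs hi n).AnyLink a b c := by
  simp only [anyCheck, Bool.or_eq_true] at h
  exact h.imp (Or.imp shortLink_of_check (Or.imp shortLink_of_check shortLink_of_check))
    (Or.imp (Or.imp longLink_of_check (Or.imp longLink_of_check longLink_of_check))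
      (Or.imp longLink_of_check (Or.imp longLink_of_check longLink_of_check)))

theorem ShortLink.symm {V : Type*} {G : SimpleGraph V} {a b c : V} (h : G.ShortLink a b c) :
    G.ShortLink c b a := by
  obtain ⟨⟨p, h1, h2, h3⟩, q, h4, h5, h6⟩ := h
  exact ⟨⟨q, h5.symm, h4.symm, h6⟩, p, h2.symm, h1.symm, h3⟩

/-- Short links are reversible, so three orders represent all six; long links are listed in all six
orders. -/
theorem AnyLink.swap {V : Type*} {G : SimpleGraph V} {a b c : V} (h : G.AnyLink a b c) :
    G.AnyLink b a c := by
  have hs : ∀ {a b c}, G.ShortLink a b c → G.ShortLink c b a := ShortLink.symm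
  unfold AnyLink at *
  rcases h with (h | h | h) | (h | h | h) | (h | h | h)
  · have := hs h; tauto
  · have := hs h; tauto
  · have := hs h; tauto
  all_goals tauto

theorem AnyLink.rotate {V : Type*} {G : SimpleGraph V} {a b c : V} (h : G.AnyLink a b c) :
    G.AnyLink b c a := by
  unfold AnyLink at *
  tauto

/-- The check visits only `c < b < a`; the symmetry of `AnyLink` recovers the other orders. -/
theorem isRich_of_check (h : richCheck A n = true) : (ofBool A hs hi n).IsRich := by
  simp only [richCheck, List.all_eq_true, List.mem_range] at h
  have nbr : ∀ a b : Fin n, b < a → ¬ (ofBool A hs hi n).Adj a b →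
      (∃ c, (ofBool A hs hi n).Adj a c ∧ (ofBool A hs hi n).Adj c b) ∧
      ∀ c, c < b → ¬ (ofBool A hs hi n).Adj a c → ¬ (ofBool A hs hi n).Adj b c →
        (ofBool A hs hi n).AnyLink a b c := by
    intro a b hba nab
    have h1 := h a a.2 b hba
    rw [show A a b = false from Bool.eq_false_iff.2 nab, cond_false, Bool.and_eq_true,
      List.any_eq_true, List.all_eq_true] at h1
    obtain ⟨⟨k, hk, hk'⟩, h2⟩ := h1
    rw [Bool.and_eq_true] at hk'
    refine ⟨⟨⟨k, List.mem_range.1 hk⟩, hk'⟩, fun c hc nac nbc => ?_⟩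
    have h3 := h2 c (List.mem_range.2 hc)
    rw [show A a c = false from Bool.eq_false_iff.2 nac,
      show A b c = false from Bool.eq_false_iff.2 nbc, Bool.false_or, Bool.false_or] at h3
    exact anyLink_of_check h3
  have tri : ∀ a b c : Fin n, b < a → (ofBool A hs hi n).Adj a b → (ofBool A hs hi n).Adj a c →
      ¬ (ofBool A hs hi n).Adj b c := by
    intro a b c hba hab hac hbc
    have h1 := h a a.2 b hba
    rw [show A a b = true from hab, cond_true, List.all_eq_true] at h1
    have h2 := h1 c (List.mem_range.2 c.2)
    rw [show A a c = true from hac, show A b c = true from hbc] at h2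
    exact absurd h2 (by decide)
  refine ⟨fun a b hab nab => ?_, fun a b c ab bc ac => ?_, ?_⟩
  · rcases lt_or_gt_of_ne hab with hlt | hlt
    · obtain ⟨⟨c, h1, h2⟩, -⟩ := nbr b a hlt fun h => nab h.symm
      exact ⟨c, h2.symm, h1.symm⟩
    · exact (nbr a b hlt nab).1
  · rcases lt_or_gt_of_ne ab.ne with hlt | hlt
    · exact tri b a c hlt ab.symm bc ac
    · exact tri a b c hlt ab ac bc
  · have key : ∀ a b c : Fin n, b < a → c < b → ¬ (ofBool A hs hi n).Adj a b →
        ¬ (ofBool A hs hi n).Adj b c → ¬ (ofBool A hs hi n).Adj a c →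
        (ofBool A hs hi n).AnyLink a b c := fun a b c h1 h2 ab bc ac => (nbr a b h1 ab).2 c h2 ac bc
    intro a b c hab hbc hac ab bc ac
    have ba := fun h : (ofBool A hs hi n).Adj b a => ab h.symm
    have cb := fun h : (ofBool A hs hi n).Adj c b => bc h.symm
    have ca := fun h : (ofBool A hs hi n).Adj c a => ac h.symm
    rcases lt_or_gt_of_ne hab with h1 | h1 <;> rcases lt_or_gt_of_ne hbc with h2 | h2 <;>
      rcases lt_or_gt_of_ne hac with h3 | h3
    · exact (key c b a h2 h1 cb ba ca).swap.rotate.rotate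
    · exact absurd (h1.trans h2) h3.asymm
    · exact (key b c a h2 h3 bc ca ba).rotate.rotate
    · exact (key b a c h1 h3 ba ac bc).swap
    · exact (key c a b h3 h1 ca ab cb).rotate
    · exact (key a c b h3 h2 ac cb ab).swap.rotate
    · exact absurd (h2.trans h1) h3.asymm
    · exact key a b c h1 h2 ab bc ac

end

/-! ### The infinite family -/

/-- Adjacency of the rich family: the vertices below `6` form a hexagon, and join the further
vertices of the same residue class modulo three; the further vertices `x < y` are adjacent
if and only if `y - x ≡ 1` modulo three. -/
def hexAdj (x y : ℕ) : Bool :=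
  bif Nat.blt x 6 then
    bif Nat.blt y 6 then !(Nat.beq (x / 3) (y / 3)) && !(Nat.beq (x % 3) (y % 3))
    else Nat.beq (x % 3) (y % 3)
  else
    bif Nat.blt y 6 then Nat.beq (x % 3) (y % 3)
    else bif Nat.blt x y then Nat.beq ((x + 1) % 3) (y % 3)
    else Nat.blt y x && Nat.beq ((y + 1) % 3) (x % 3)

theorem hexAdj_iff (x y : ℕ) : hexAdj x y = true ↔
    (x < 6 ∧ y < 6 ∧ x / 3 ≠ y / 3 ∧ x % 3 ≠ y % 3) ∨ (x < 6 ∧ 6 ≤ y ∧ x % 3 = y % 3) ∨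
    (6 ≤ x ∧ y < 6 ∧ x % 3 = y % 3) ∨ (6 ≤ x ∧ x < y ∧ (x + 1) % 3 = y % 3) ∨
    (6 ≤ y ∧ y < x ∧ (y + 1) % 3 = x % 3) := by
  simp only [hexAdj, Bool.cond_eq_ite, Nat.blt_eq]
  split_ifs <;> simp only [Bool.and_eq_true, Bool.not_eq_true', Nat.beq_eq, Nat.blt_eq,
    ← Bool.not_eq_true] <;> omega

theorem hexAdj_symm (x y : ℕ) : hexAdj x y = hexAdj y x := by
  rw [Bool.eq_iff_iff, hexAdj_iff, hexAdj_iff]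
  omega

theorem hexAdj_irrefl (x : ℕ) : hexAdj x x = false := by
  rw [← Bool.not_eq_true, hexAdj_iff]
  omega

/-- The rich family. -/
abbrev hexGraph (n : ℕ) : SimpleGraph (Fin n) := ofBool hexAdj hexAdj_symm hexAdj_irrefl n

/-- The embedding of `hexGraph n` into `hexGraph (n + 3)` which skips `j`, `j + 1`, `j + 2`. -/
def hexSkip (n j : ℕ) (hj : 6 ≤ j) : hexGraph n ↪g hexGraph (n + 3) where
  toFun x := ⟨if (x : ℕ) < j then x else x + 3, by split_ifs <;> omega⟩
  inj' x y h := by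
    simp only [Fin.mk.injEq] at h
    ext
    split_ifs at h <;> omega
  -- A shift by three preserves residues and order, and `6 ≤ j` leaves the hexagon fixed.
  map_rel_iff' {x y} := by
    show hexAdj (if (x : ℕ) < j then x else x + 3) (if (y : ℕ) < j then y else y + 3) = true ↔
      hexAdj x y = true
    rw [hexAdj_iff, hexAdj_iff]
    split_ifs <;> omega

theorem mem_range_hexSkip {n j : ℕ} (hj : 6 ≤ j) (hjn : j ≤ n) {a : Fin (n + 3)}
    (ha : (a : ℕ) < j ∨ j + 3 ≤ a) : a ∈ Set.range (hexSkip n j hj) := by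
  rcases ha with ha | ha
  · refine ⟨⟨a, by omega⟩, Fin.ext ?_⟩
    show (if (a : ℕ) < j then (a : ℕ) else a + 3) = a
    rw [if_pos ha]
  · refine ⟨⟨a - 3, by omega⟩, Fin.ext ?_⟩
    show (if (a : ℕ) - 3 < j then (a : ℕ) - 3 else a - 3 + 3) = a
    rw [if_neg (by omega)]
    omega

/-- Three vertices cannot meet all four disjoint blocks starting at 6, 9, 12 and 15, so they lie in
the image of some `hexSkip`. The last block ends at 17, whence `15 ≤ n`. -/
theorem hexGraph_isRich_add {n : ℕ} (hn : 15 ≤ n) (h : (hexGraph n).IsRich) :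
    (hexGraph (n + 3)).IsRich := by
  refine h.of_embeddings fun a b c => ?_
  have : ∃ j, 6 ≤ j ∧ j ≤ n ∧ ((a : ℕ) < j ∨ j + 3 ≤ a) ∧ ((b : ℕ) < j ∨ j + 3 ≤ b) ∧
      ((c : ℕ) < j ∨ j + 3 ≤ c) := by
    by_contra! hcon
    have h6 := hcon 6 (by omega) (by omega)
    have h9 := hcon 9 (by omega) (by omega)
    have h12 := hcon 12 (by omega) (by omega)
    have h15 := hcon 15 (by omega) (by omega)
    omega
  obtain ⟨j, hj, hjn, ha, hb, hc⟩ := this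
  exact ⟨hexSkip n j hj, mem_range_hexSkip hj hjn ha, mem_range_hexSkip hj hjn hb,
    mem_range_hexSkip hj hjn hc⟩

theorem richCheck_hexAdj : ∀ n ∈ List.range' 11 7, richCheck hexAdj n = true := by decide +kernel

theorem hexGraph_isRich (n : ℕ) (hn : 11 ≤ n) : (hexGraph n).IsRich := by
  induction n using Nat.strong_induction_on with
  | _ n ih =>
    by_cases h17 : n ≤ 17
    · exact isRich_of_check (richCheck_hexAdj n (by simp; omega))
    · obtain ⟨m, rfl⟩ : ∃ m, n = m + 3 := ⟨n - 3, by omega⟩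
      exact hexGraph_isRich_add (by omega) (ih m (by omega) (by omega))

/-! ### The small orders and the conclusion -/

/-- Adjacency of the Andrásfai graphs. -/
def andrasfaiAdj (x y : ℕ) : Bool :=
  (Nat.blt x y && Nat.beq ((x + 1) % 3) (y % 3)) || (Nat.blt y x && Nat.beq ((y + 1) % 3) (x % 3))

theorem andrasfaiAdj_symm (x y : ℕ) : andrasfaiAdj x y = andrasfaiAdj y x := Bool.or_comm _ _

theorem andrasfaiAdj_irrefl (x : ℕ) : andrasfaiAdj x x = false := by
  simp [andrasfaiAdj, ← Bool.not_eq_true]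

/-- Adjacency of complete bipartite graphs, by parity. -/
def parityAdj (x y : ℕ) : Bool := !(Nat.beq (x % 2) (y % 2))

theorem parityAdj_symm (x y : ℕ) : parityAdj x y = parityAdj y x := by
  rw [Bool.eq_iff_iff]
  simp only [parityAdj, Bool.not_eq_true', ← Bool.not_eq_true, Nat.beq_eq]
  omega

theorem parityAdj_irrefl (x : ℕ) : parityAdj x x = false := by simp [parityAdj]

/-- The small graphs are the path on three vertices, the 4-cycle, the 5-cycle and the 8-cycle with
its four long diagonals. -/
theorem exists_isRich {n : ℕ} (hn : n ∈ ({3, 4, 5, 8} : Set ℕ) ∨ 11 ≤ n) :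
    ∃ G : SimpleGraph (Fin n), G.IsRich := by
  rcases hn with (rfl | rfl | rfl | rfl) | hn
  · exact ⟨_, isRich_of_check (hs := andrasfaiAdj_symm) (hi := andrasfaiAdj_irrefl)
      (by decide +kernel)⟩
  · exact ⟨_, isRich_of_check (hs := parityAdj_symm) (hi := parityAdj_irrefl) (by decide +kernel)⟩
  · exact ⟨_, isRich_of_check (hs := andrasfaiAdj_symm) (hi := andrasfaiAdj_irrefl)
      (by decide +kernel)⟩
  · exact ⟨_, isRich_of_check (hs := andrasfaiAdj_symm) (hi := andrasfaiAdj_irrefl)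
      (by decide +kernel)⟩
  · exact ⟨_, hexGraph_isRich n hn⟩

end SimpleGraph

theorem theorem4p4 (n : ℕ) :
    (∃ G : SimpleGraph (Fin n), G.mpNumber = 2 ∧ G.ediam = 2) ↔
      n ∈ ({3, 4, 5, 8} : Set ℕ) ∨ 11 ≤ n := by
  constructor
  · rintro ⟨G, hmp, hd⟩
    have h : G.IsTight := ⟨SimpleGraph.commonNbrs_of_ediam hd, fun hab hbc hac =>
      SimpleGraph.onInducedPath_of_mpNumber_eq_two hmp hab hbc hac⟩
    -- Diameter two yields nonadjacent vertices with a common neighbour, hence three vertices;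
    -- orders 3 to 5 are all allowed.
    have h3 : 3 ≤ n := by
      obtain ⟨a, b, c, hab, -, hac, hcb⟩ := SimpleGraph.exists_nonadj_of_ediam hd
      have : [a, b, c].Nodup := by simp [hab, hac.ne, hcb.ne']
      simpa using this.length_le_card
    simp only [Set.mem_insert_iff, Set.mem_singleton_iff]
    by_cases h5 : n ≤ 5
    · omega
    · have := h.card_cases (by rw [Fintype.card_fin]; omega)
      rw [Fintype.card_fin] at this
      omega
  · intro hn
    obtain ⟨G, hG⟩ := SimpleGraph.exists_isRich hn
    refine ⟨G, hG.mpNumber_and_ediam ?_⟩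
    rw [Fintype.card_fin]
    simp only [Set.mem_insert_iff, Set.mem_singleton_iff] at hn
    omega
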